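/- \textbf{Model.} $n$ anonymous, oblivious robots are points of $\mathbb{R}^2$ and proceed in fully synchronous rounds. In each round every robot observes the multiset of positions of all robots in its own ego-centered coordinate system (orientation, chirality and unit of length are chosen by an adversary that knows the past and gives robots located at the same point the same system). From this observation alone the common algorithm computes a nonempty finite multiset $Pos$ of possible destinations; the robot moves to an element of $Pos$ chosen uniformly at random, independently of the other robots, which uses $\log|Pos|$ random bits; bits used by robots that are alone at their location are not counted ($\log=\log_2$). An algorithm uses \emph{only global weak multiplicity detection} if $Pos$ depends only on which points are occupied and which are occupied by more than one robot, and \emph{no multiplicity detection} if it depends only on which points are occupied. It is a \emph{scattering algorithm} if, for every $n$, every initial configuration and every adversary, with probability $1$ a configuration is reached in which no two robots share a location. Its time complexity and its random bit complexity are the expected number of rounds, respectively of random bits used, until such a configuration is first reached, in the worst case over initial configurations of $n$ robots and adversaries. \textbf{Algorithm.} Let $f(n)=\lfloor\log\log n\rfloor$ for $n\ge 2$ and $f(0)=f(1)=0$, and $f^{-1}(y)=\max\{x\in\mathbb{N} : f(x)=y\}$. Let $\mathcal{N}\in\mathbb{N}$ be such that for all $m>\mathcal{N}$ and $1\le k\le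 8m^3$, if $m$ robots choose independently and uniformly among $k$ destinations, then some destination is chosen by more than $\frac{m}{k}(1+k^{3/4})$ robots with probability at most $\frac{1}{2k}$. In $\mathcal{SA}_{\log\circ\log}$, a robot that observes $u$ occupied points sets $x=f^{-1}(f(u)+1)$ and $k=\max(8\mathcal{N}^3,16x^4,u^3)$ and takes for $Pos$ a set of $k$ distinct points in its (open) Voronoi cell with respect to the occupied points, computed without multiplicity detection. \textbf{Corollary.} Such an $\mathcal{N}$ exists. For every such $\mathcal{N}$, the algorithm $\mathcal{SA}_{\log\circ\log}$ can be implemented, and, however the points of $Pos$ are picked in the Voronoi cells, it is a scattering algorithm with time complexity $\Theta(\log\log n)$ and random bit complexity $\Theta(n\log n)$. It is optimal for both: every scattering algorithm (with any kind of multiplicity detection) has random bit complexity at least $n\log n$ for every $n$, and every scattering algorithm that uses only global weak multiplicity detection and is random bit optimal, i.e. has random bit complexity $O(n\log n)$, has time complexity $\Omega(\log\log n)$. -/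

import Mathlib

open Filter Topology
open scoped ENNReal

noncomputable section

namespace Scattering

/-- The Euclidean plane in which the robots live. -/
abbrev Plane : Type := EuclideanSpace ℝ (Fin 2)

/-- A configuration of `n` robots. The labels serve the analysis only: what a robot observes
(see `localSnapshot`) does not contain them. -/
abbrev Config (n : ℕ) : Type := Fin n → Plane

/-- No two robots share the same location. -/
def Scattered {n : ℕ} (C : Config n) : Prop := Function.Injective C

open Classical in
/-- The number of robots located at `P`. -/
def multiplicity {n : ℕ} (C : Config n) (P : Plane) : ℕ :=
  (Finset.univ.filter fun i => C i = P).card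

/-- The orientation, chirality and unit of length of a robot's ego-centered coordinate system;
its origin is the location of the robot. -/
structure Frame where
  iso : Plane ≃ₗᵢ[ℝ] Plane
  scale : ℝ
  scale_pos : 0 < scale

/-- The coordinates of `Q` in the frame of a robot located at `P`. -/
def Frame.toLocal (φ : Frame) (P Q : Plane) : Plane := φ.scale • φ.iso (Q - P)

/-- The point with coordinates `X` in the frame of a robot located at `P`. -/
def Frame.toGlobal (φ : Frame) (P X : Plane) : Plane := P + φ.scale⁻¹ • φ.iso.symm X

/-- The positions of all robots, with multiplicity, in the coordinates of a robot located at `P`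
(so that this robot itself is at `0`). -/
def localSnapshot {n : ℕ} (φ : Frame) (C : Config n) (P : Plane) : Multiset Plane :=
  Finset.univ.val.map fun i => φ.toLocal P (C i)

/-- An oblivious algorithm, common to all robots. Given the snapshot in its own coordinates, with
full multiplicity information, a robot computes a nonempty finite multiset of possible
destinations in its own coordinates, and then chooses one of them uniformly at random. Weaker
multiplicity detection is expressed by `GlobalWeakDetection` and `NoDetection`. -/
structure Algorithm where
  dest : Multiset Plane → Multiset Plane
  dest_ne_zero : ∀ S, dest S ≠ 0

open Classical in
/-- The algorithm uses at most global weak multiplicity detection: it may depend only on which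
points are occupied, and on which points are occupied by more than one robot. -/
def Algorithm.GlobalWeakDetection (A : Algorithm) : Prop :=
  ∀ S S' : Multiset Plane, (∀ Q, Q ∈ S ↔ Q ∈ S') →
    (∀ Q, 1 < S.count Q ↔ 1 < S'.count Q) → A.dest S = A.dest S'

/-- The algorithm uses no multiplicity detection: it may depend only on which points are
occupied. -/
def Algorithm.NoDetection (A : Algorithm) : Prop :=
  ∀ S S' : Multiset Plane, (∀ Q, Q ∈ S ↔ Q ∈ S') → A.dest S = A.dest S'

/-- The possible destinations, in global coordinates, of a robot located at `P`. -/
def Algorithm.destinations (A : Algorithm) {n : ℕ} (φ : Frame) (C : Config n) (P : Plane) :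
    Multiset Plane :=
  (A.dest (localSnapshot φ C P)).map (φ.toGlobal P)

theorem Algorithm.destinations_ne_zero (A : Algorithm) {n : ℕ} (φ : Frame) (C : Config n)
    (P : Plane) : A.destinations φ C P ≠ 0 := by
  simpa [Algorithm.destinations] using A.dest_ne_zero _

open Classical in
theorem Algorithm.nonempty_choices (A : Algorithm) {n : ℕ} (φ : Plane → Frame) (C : Config n) :
    Nonempty (∀ i : Fin n, (A.destinations (φ (C i)) C (C i)).ToType) := by
  refine ⟨fun i => Classical.choice ?_⟩
  obtain ⟨x, hx⟩ := Multiset.exists_mem_of_ne_zero (A.destinations_ne_zero (φ (C i)) C (C i))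
  exact ⟨⟨x, ⟨0, Multiset.count_pos.2 hx⟩⟩⟩

open Classical in
/-- One fully synchronous round. Robots located at the same point `P` share the frame `φ P`.
Every robot chooses one of its possible destinations, uniformly and independently of the others
(that is, the tuple of choices is uniform), and moves to it. -/
def Algorithm.step (A : Algorithm) {n : ℕ} (φ : Plane → Frame) (C : Config n) :
    PMF (Config n) :=
  haveI := A.nonempty_choices φ C
  (PMF.uniformOfFintype (∀ i : Fin n, (A.destinations (φ (C i)) C (C i)).ToType)).map
    fun c i => (c i).1

/-- A finite execution: the current configuration and the list of the earlier ones, most recent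
first. -/
abbrev History (n : ℕ) : Type := Config n × List (Config n)

/-- The adversary chooses, in each round and depending on the whole past, the coordinate systems
of the robots; robots located at the same point get the same one. -/
abbrev Adversary (n : ℕ) : Type := History n → Plane → Frame

/-- The law of the first `t` rounds of the execution that starts in `C₀`. -/
def Algorithm.execution (A : Algorithm) {n : ℕ} (adv : Adversary n) (C₀ : Config n) :
    ℕ → PMF (History n)
  | 0 => PMF.pure (C₀, [])
  | t + 1 => (A.execution adv C₀ t).bind fun h =>
      (A.step (adv h) h.1).map fun C => (C, h.1 :: h.2)

/-- No configuration met so far is scattered. -/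
def Unscattered {n : ℕ} (h : History n) : Prop :=
  ¬ Scattered h.1 ∧ ∀ C ∈ h.2, ¬ Scattered C

open Classical in
/-- The expectation, over all executions, of the sum of the weights of the rounds that are
performed until the first scattered configuration is reached. The round that follows the
history `h` has weight `w h`. -/
def Algorithm.expectedTotal (A : Algorithm) {n : ℕ} (adv : Adversary n) (C₀ : Config n)
    (w : History n → ℝ≥0∞) : ℝ≥0∞ :=
  ∑' t : ℕ, ∑' h : History n, A.execution adv C₀ t h * (if Unscattered h then w h else 0)

open Classical in
/-- The number of random bits used in one round: a robot that chooses among `k` possible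
destinations uses `log₂ k` bits, and only robots located at points of multiplicity count. -/
def Algorithm.roundBits (A : Algorithm) {n : ℕ} (φ : Plane → Frame) (C : Config n) : ℝ≥0∞ :=
  ∑ i : Fin n, if 2 ≤ multiplicity C (C i) then
    ENNReal.ofReal (Real.logb 2 (Multiset.card (A.destinations (φ (C i)) C (C i)))) else 0

/-- The time complexity: the expected number of rounds until `n` robots are scattered, in the
worst case over initial configurations and adversaries. -/
def Algorithm.rounds (A : Algorithm) (n : ℕ) : ℝ≥0∞ :=
  ⨆ (adv : Adversary n) (C₀ : Config n), A.expectedTotal adv C₀ fun _ => 1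

/-- The random bit complexity: the expected number of random bits used until `n` robots are
scattered, in the worst case over initial configurations and adversaries. -/
def Algorithm.bits (A : Algorithm) (n : ℕ) : ℝ≥0∞ :=
  ⨆ (adv : Adversary n) (C₀ : Config n),
    A.expectedTotal adv C₀ fun h => A.roundBits (adv h) h.1

open Classical in
/-- `A` is a scattering algorithm: from every initial configuration of any number of robots, and
against every adversary, a scattered configuration is reached with probability one. -/
def Algorithm.IsScattering (A : Algorithm) : Prop :=
  ∀ (n : ℕ) (adv : Adversary n) (C₀ : Config n),
    Tendsto (fun t : ℕ => ∑' h : History n,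
      A.execution adv C₀ t h * (if Unscattered h then 1 else 0)) atTop (𝓝 0)

/-- `F(n) = O(g(n))`. -/
def IsBigO (F : ℕ → ℝ≥0∞) (g : ℕ → ℝ) : Prop :=
  ∃ c : ℝ, 0 < c ∧ ∀ᶠ n in atTop, F n ≤ ENNReal.ofReal (c * g n)

/-- `F(n) = Ω(g(n))`. -/
def IsBigOmega (F : ℕ → ℝ≥0∞) (g : ℕ → ℝ) : Prop :=
  ∃ c : ℝ, 0 < c ∧ ∀ᶠ n in atTop, ENNReal.ofReal (c * g n) ≤ F n

/-- `F(n) = Θ(g(n))`. -/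
def IsBigTheta (F : ℕ → ℝ≥0∞) (g : ℕ → ℝ) : Prop := IsBigO F g ∧ IsBigOmega F g

/-- `log log n`, in base two. -/
def logLog (n : ℕ) : ℝ := Real.logb 2 (Real.logb 2 n)

/-- `n log n`, in base two. -/
def nLog (n : ℕ) : ℝ := n * Real.logb 2 n

/-- The open Voronoi cell of the site `P` among the sites `U`. -/
def voronoiCell (U : Set Plane) (P : Plane) : Set Plane :=
  {Q | ∀ P' ∈ U, P' ≠ P → dist Q P < dist Q P'}

/-- `f⁻¹(y) = max {x | f x = y}`, for `f` monotone and surjective. -/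
def maxInv (f : ℕ → ℕ) (y : ℕ) : ℕ := sSup {x | f x = y}

open Classical in
/-- When more than `N` robots choose independently and uniformly among `k ≤ 8 m ^ 3` destinations,
where `m` is the number of robots, some destination is chosen by more than
`(m / k) * (1 + k ^ (3 / 4))` robots with probability at most `1 / (2 k)`. -/
def IsThreshold (N : ℕ) : Prop :=
  ∀ m k : ℕ, N < m → 1 ≤ k → k ≤ 8 * m ^ 3 →
    ((Finset.univ.filter fun X : Fin m → Fin k =>
        ∃ j, (m : ℝ) / k * (1 + (k : ℝ) ^ (3 / 4 : ℝ)) <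
          ((Finset.univ.filter fun i => X i = j).card : ℝ)).card : ℝ) / (k : ℝ) ^ m
      ≤ 1 / (2 * k)

/-- The number of destinations that `SA_f` computes when it observes `u` occupied points. -/
def saCount (f : ℕ → ℕ) (N u : ℕ) : ℕ :=
  max (8 * N ^ 3) (max (16 * maxInv f (f u + 1) ^ 4) (u ^ 3))

open Classical in
/-- `A` is an implementation of `SA_f`: without multiplicity detection, a robot (at `0` in its own
coordinates) computes a set of `saCount f N u` distinct points in its Voronoi cell, where `u` is
the number of occupied points, and chooses among them. How the points are picked inside the cell
is left open. -/
structure Algorithm.IsSA (A : Algorithm) (f : ℕ → ℕ) (N : ℕ) : Prop where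
  noDetection : A.NoDetection
  nodup : ∀ S : Multiset Plane, 0 ∈ S → (A.dest S).Nodup
  card_dest : ∀ S : Multiset Plane, 0 ∈ S →
    Multiset.card (A.dest S) = saCount f N S.toFinset.card
  mem_cell : ∀ S : Multiset Plane, 0 ∈ S → ∀ Q ∈ A.dest S, Q ∈ voronoiCell {P | P ∈ S} 0

/-- The monotone surjection `⌊log₂ log₂ n⌋` of the natural numbers (`0` for `n < 4`). -/
def logLogNat (n : ℕ) : ℕ := Nat.log 2 (Nat.log 2 n)

end Scattering

end

/-! Bits. The entropy of a configuration, the sum over all robots of the logarithm of the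
multiplicity at their location, is `n log n` when all robots are gathered and `0` when they are
scattered. A group that spreads over at most `k` places loses at most `log k` per member
(`card_mul_logb_card_le`, from `log z ≤ z - 1`), so a round never lowers the entropy by more than
the bits it uses (`entropy_le_roundBits_add`). As scattering is almost sure, `n log n` bits are
needed.

Time. Weak detection hides the number of robots: the number of destinations computed in a
configuration with `u` occupied points is also computed in one with only `O(u)` robots, most of them
at one point. There, the first round alone forces it to be polynomial in `u` when the bit complexity
is `O(n log n)` (`card_destinations_le_of_bits_le`). So `log u` grows at most by a constant factor
per round, up to an additive constant, and `Ω(log log n)` rounds pass before `u = n`.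

Upper bounds. Voronoi cells are disjoint, so the level `⌊log log u⌋` never drops. In each round
there is a set of at most `k / 2` pairs of robots whose separation scatters the robots or raises the
level (`exists_pairs_forcing_progress`), and a pair meets with probability at most `1 / k`; progress
thus has probability at least one half. Two expected rounds per level give `O(log log n)` rounds. A
round at level `y` costs `O(n 2^y)` bits, and the geometric sum over the levels is `O(n log n)`.

The existence of the threshold constant is a separate first-moment estimate
(`isThreshold_of_large`). -/

namespace Scattering

noncomputable section

open scoped Classical

/-! ### Balls into bins: existence of the threshold constant. -/

section BallsIntoBins

/-- The number of ways to throw `m` balls into `k` bins so that some bin gets at least `r`. -/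
theorem card_exists_heavy_bin_le (m k r : ℕ) :
    (Finset.univ.filter fun X : Fin m → Fin k =>
        ∃ j, r ≤ (Finset.univ.filter fun i => X i = j).card).card * k ^ r
      ≤ k * m.choose r * k ^ m := by
  -- Union bound over a bin and `r` balls that all fall into it.
  have hsub : (Finset.univ.filter fun X : Fin m → Fin k =>
        ∃ j, r ≤ (Finset.univ.filter fun i => X i = j).card) ⊆
      ((Finset.univ : Finset (Fin k)) ×ˢ Finset.powersetCard r (Finset.univ : Finset (Fin m))).biUnion
        fun p => Finset.univ.filter fun X : Fin m → Fin k => ∀ i ∈ p.2, X i = p.1 := by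
    intro X hX
    obtain ⟨j, hj⟩ := (Finset.mem_filter.1 hX).2
    obtain ⟨s, hs, hsr⟩ := Finset.exists_subset_card_eq hj
    refine Finset.mem_biUnion.2 ⟨(j, s), ?_, ?_⟩
    · simp [Finset.mem_powersetCard, hsr]
    · exact Finset.mem_filter.2 ⟨Finset.mem_univ _, fun i hi => (Finset.mem_filter.1 (hs hi)).2⟩
  have hfix : ∀ p ∈ (Finset.univ : Finset (Fin k)) ×ˢ
      Finset.powersetCard r (Finset.univ : Finset (Fin m)),
      (Finset.univ.filter fun X : Fin m → Fin k => ∀ i ∈ p.2, X i = p.1).card * k ^ r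
        = k ^ m := by
    rintro ⟨j, s⟩ hp
    have hs : s.card = r := by
      simpa [Finset.mem_powersetCard] using hp
    have : (Finset.univ.filter fun X : Fin m → Fin k => ∀ i ∈ s, X i = j)
        = Fintype.piFinset fun i => if i ∈ s then {j} else Finset.univ := by
      ext X
      simp only [Finset.mem_filter, Finset.mem_univ, true_and, Fintype.mem_piFinset]
      refine forall_congr' fun i => ?_
      split_ifs with h <;> simp [h]
    simp only [this, Fintype.card_piFinset]
    have h2 : ∀ i : Fin m, (if i ∈ s then ({j} : Finset (Fin k)) else Finset.univ).card
        = if i ∈ s then 1 else k := by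
      intro i; split_ifs <;> simp
    rw [Finset.prod_congr rfl fun i _ => h2 i, Finset.prod_ite]
    simp only [Finset.prod_const_one, one_mul, Finset.prod_const]
    rw [← pow_add]
    congr 1
    have := Finset.card_filter_add_card_filter_not (s := (Finset.univ : Finset (Fin m)))
      (fun i => i ∈ s)
    simp only [Finset.filter_univ_mem, hs, Finset.card_univ, Fintype.card_fin] at this
    omega
  calc _ ≤ (∑ p ∈ (Finset.univ : Finset (Fin k)) ×ˢ
        Finset.powersetCard r (Finset.univ : Finset (Fin m)),
        (Finset.univ.filter fun X : Fin m → Fin k => ∀ i ∈ p.2, X i = p.1).card) * k ^ r := by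
        gcongr
        exact (Finset.card_le_card hsub).trans Finset.card_biUnion_le
    _ = _ := by
        rw [Finset.sum_mul, Finset.sum_congr rfl hfix]
        simp [Finset.card_product, Finset.card_powersetCard]

/-- In terms of `y = k ^ (1 / 8)` this is `e y ≤ 1 + y ^ 6`, true for `y ≥ 1.18`, and `4 ^ (1 / 8) >
1.18`. It makes the ratio `e m / (r k)` at most `k ^ (-1 / 8)` in the union bound below. -/
theorem exp_one_mul_rpow_le (k : ℕ) (hk : 4 ≤ k) :
    Real.exp 1 * (k : ℝ) ^ (1 / 8 : ℝ) ≤ 1 + (k : ℝ) ^ (3 / 4 : ℝ) := by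
  have hk' : (4 : ℝ) ≤ k := by exact_mod_cast hk
  set y : ℝ := (k : ℝ) ^ (1 / 8 : ℝ) with hy
  have h6 : (k : ℝ) ^ (3 / 4 : ℝ) = y ^ 6 := by
    rw [hy, ← Real.rpow_natCast, ← Real.rpow_mul (by positivity)]
    norm_num
  have h8 : y ^ 8 = k := by
    rw [hy, ← Real.rpow_natCast, ← Real.rpow_mul (by positivity)]
    norm_num
  have hy0 : 0 ≤ y := by positivity
  have hy1 : (1.18 : ℝ) ≤ y := by
    by_contra h
    push Not at h
    have : y ^ 8 < 1.18 ^ 8 := by gcongr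
    norm_num at this
    linarith
  have he := Real.exp_one_lt_d9
  rw [h6]
  have h3 : (1.18 : ℝ) ^ 3 ≤ y ^ 3 := by gcongr
  nlinarith [mul_nonneg (sub_nonneg.2 hy1) (sub_nonneg.2 hy1), sq_nonneg (y ^ 3 - 1.65),
    mul_nonneg hy0 (sub_nonneg.2 hy1), mul_nonneg hy0 (mul_nonneg (sub_nonneg.2 hy1) (sub_nonneg.2 hy1))]

theorem choose_mul_pow_le (m r : ℕ) : (m.choose r : ℝ) * (r : ℝ) ^ r ≤ (Real.exp 1 * m) ^ r := by
  have h1 : (m.choose r : ℝ) ≤ (m : ℝ) ^ r / r.factorial := Nat.choose_le_pow_div r m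
  have h2 := Real.pow_div_factorial_le_exp r (Nat.cast_nonneg r) r
  have h3 : Real.exp r = Real.exp 1 ^ r := by rw [← Real.exp_nat_mul, mul_one]
  calc (m.choose r : ℝ) * (r : ℝ) ^ r ≤ (m : ℝ) ^ r / r.factorial * (r : ℝ) ^ r := by gcongr
    _ = (m : ℝ) ^ r * ((r : ℝ) ^ r / r.factorial) := by ring
    _ ≤ (m : ℝ) ^ r * Real.exp r := by gcongr
    _ = _ := by rw [h3, mul_pow, mul_comm]

/-- With `r = ⌈θ⌉`, the union bound gives probability at most `k (e m / (r k)) ^ r ≤ k * k ^ (-r /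
8)`. As `r ≥ 24`, this is at most `k ^ (-2) ≤ 1 / (2 k)`. -/
theorem isThreshold_of_large : IsThreshold (8 * 24 ^ 4) := by
  intro m k hm hk1 hk
  have hm0 : (0 : ℝ) < m := by exact_mod_cast (by omega : 0 < m)
  have hk0 : (0 : ℝ) < k := by exact_mod_cast hk1
  set θ : ℝ := (m : ℝ) / k * (1 + (k : ℝ) ^ (3 / 4 : ℝ)) with hθ
  rcases lt_or_ge k 4 with hk4 | hk4
  -- For `k ≤ 3` the bound `θ` is at least `m`, so no bin can exceed it.
  · have hle : (m : ℝ) ≤ θ := by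
      have : (k : ℝ) ≤ 1 + (k : ℝ) ^ (3 / 4 : ℝ) := by
        set y : ℝ := (k : ℝ) ^ (1 / 4 : ℝ) with hy
        have h3 : (k : ℝ) ^ (3 / 4 : ℝ) = y ^ 3 := by
          rw [hy, ← Real.rpow_natCast, ← Real.rpow_mul (by positivity)]
          norm_num
        have h4 : y ^ 4 = k := by
          rw [hy, ← Real.rpow_natCast, ← Real.rpow_mul (by positivity)]
          norm_num
        have hy0 : 0 ≤ y := by positivity
        have hk3 : (k : ℝ) ≤ 3 := by exact_mod_cast (by omega : k ≤ 3)
        have hy1 : y ≤ 1.32 := by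
          by_contra h
          push Not at h
          have : (1.32 : ℝ) ^ 4 < y ^ 4 := by gcongr
          norm_num at this
          linarith
        rw [h3, ← h4]
        have h5 : y ^ 3 ≤ 1.32 ^ 3 := by gcongr
        norm_num at h5
        have : y ^ 3 * (y - 1) ≤ 2.3 * 0.32 := by
          rcases le_or_gt y 1 with h | h
          · nlinarith [pow_nonneg hy0 3]
          · exact mul_le_mul (by linarith) (by linarith) (by linarith) (by norm_num)
        nlinarith
      rw [hθ, div_mul_eq_mul_div, le_div_iff₀ hk0]
      gcongr
    rw [Finset.filter_false_of_mem]
    · simp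
    · rintro X - ⟨j, hj⟩
      have : ((Finset.univ.filter fun i => X i = j).card : ℝ) ≤ m := by
        exact_mod_cast (Finset.card_le_univ _).trans (by simp)
      linarith
  set r : ℕ := ⌈θ⌉₊ with hr
  have hθr : θ ≤ r := Nat.le_ceil θ
  -- `θ ≥ m / k ^ (1 / 4)`, and `m ^ 4 / k ≥ m / 8 > 24 ^ 4`: this fixes the constant `8 * 24 ^ 4`.
  have hr24 : 24 ≤ r := by
    have h1 : (m : ℝ) * (k : ℝ) ^ (-(1 / 4) : ℝ) ≤ θ := by
      have : (k : ℝ) ^ (-(1 / 4) : ℝ) = (k : ℝ) ^ (3 / 4 : ℝ) / k := by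
        rw [← Real.rpow_sub_one hk0.ne']
        norm_num
      rw [this, hθ, mul_div_assoc', div_mul_eq_mul_div]
      gcongr
      linarith
    have h2 : (24 : ℝ) ≤ m * (k : ℝ) ^ (-(1 / 4) : ℝ) := by
      set z : ℝ := (k : ℝ) ^ (1 / 4 : ℝ) with hz
      have hz4 : z ^ 4 = k := by
        rw [hz, ← Real.rpow_natCast, ← Real.rpow_mul (by positivity)]
        norm_num
      have hz0 : 0 < z := by positivity
      rw [Real.rpow_neg hk0.le, ← div_eq_mul_inv, le_div_iff₀ hz0]
      by_contra h
      push Not at h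
      have h3 : (m : ℝ) ^ 4 < (24 * z) ^ 4 := by gcongr
      rw [mul_pow, hz4] at h3
      have h4 : (k : ℝ) ≤ 8 * (m : ℝ) ^ 3 := by exact_mod_cast hk
      have h5 : ((8 * 24 ^ 4 : ℕ) : ℝ) < m := by exact_mod_cast hm
      push_cast at h5
      have h6 : (8 * 24 ^ 4 : ℝ) * (m : ℝ) ^ 3 < m * (m : ℝ) ^ 3 := by gcongr; norm_num; linarith
      nlinarith
    have : (24 : ℝ) ≤ r := h2.trans (h1.trans hθr)
    exact_mod_cast this
  have hcount := card_exists_heavy_bin_le m k r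
  set N₁ := (Finset.univ.filter fun X : Fin m → Fin k =>
        ∃ j, r ≤ (Finset.univ.filter fun i => X i = j).card).card with hN₁
  have hsub : ((Finset.univ.filter fun X : Fin m → Fin k =>
        ∃ j, θ < ((Finset.univ.filter fun i => X i = j).card : ℝ)).card : ℝ) ≤ N₁ := by
    rw [hN₁]
    refine Nat.cast_le.2 (Finset.card_le_card ?_)
    intro X
    simp only [Finset.mem_filter, Finset.mem_univ, true_and]
    rintro ⟨j, hj⟩
    exact ⟨j, Nat.ceil_le.2 hj.le⟩
  have hr0 : (0 : ℝ) < r := by exact_mod_cast (by omega : 0 < r)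
  have hbase : Real.exp 1 * m * (k : ℝ) ^ (1 / 8 : ℝ) ≤ r * k := by
    have h1 := exp_one_mul_rpow_le k hk4
    have h2 : (m : ℝ) * (1 + (k : ℝ) ^ (3 / 4 : ℝ)) = θ * k := by
      rw [hθ]; field_simp
    calc _ = m * (Real.exp 1 * (k : ℝ) ^ (1 / 8 : ℝ)) := by ring
      _ ≤ m * (1 + (k : ℝ) ^ (3 / 4 : ℝ)) := by gcongr
      _ = θ * k := h2
      _ ≤ _ := by gcongr
  have hk3 : (k : ℝ) ^ 3 ≤ ((k : ℝ) ^ (1 / 8 : ℝ)) ^ r := by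
    have : (k : ℝ) ^ 3 = ((k : ℝ) ^ (1 / 8 : ℝ)) ^ 24 := by
      rw [← Real.rpow_natCast ((k : ℝ) ^ (1 / 8 : ℝ)), ← Real.rpow_mul (by positivity)]
      norm_num
    rw [this]
    refine pow_le_pow_right₀ (Real.one_le_rpow ?_ (by norm_num)) hr24
    exact_mod_cast hk1
  have hchoose : (m.choose r : ℝ) * (k : ℝ) ^ 3 ≤ (k : ℝ) ^ r := by
    have h1 := choose_mul_pow_le m r
    have h2 : (m.choose r : ℝ) * (k : ℝ) ^ 3 * (r : ℝ) ^ r ≤ (k : ℝ) ^ r * (r : ℝ) ^ r := by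
      calc _ = (m.choose r : ℝ) * (r : ℝ) ^ r * (k : ℝ) ^ 3 := by ring
        _ ≤ (Real.exp 1 * m) ^ r * ((k : ℝ) ^ (1 / 8 : ℝ)) ^ r := by gcongr
        _ = (Real.exp 1 * m * (k : ℝ) ^ (1 / 8 : ℝ)) ^ r := (mul_pow _ _ _).symm
        _ ≤ (r * k) ^ r := by gcongr
        _ = _ := by rw [mul_pow, mul_comm]
    exact le_of_mul_le_mul_right h2 (by positivity)
  have hcount' : (N₁ : ℝ) * (k : ℝ) ^ r ≤ k * m.choose r * (k : ℝ) ^ m := by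
    exact_mod_cast hcount
  have hkm : (0 : ℝ) < (k : ℝ) ^ m := by positivity
  have hkr : (0 : ℝ) < (k : ℝ) ^ r := by positivity
  have h4k : (4 : ℝ) ≤ k := by exact_mod_cast hk4
  rw [div_le_div_iff₀ hkm (by positivity), one_mul]
  refine (mul_le_mul_of_nonneg_right hsub (by positivity)).trans ?_
  refine le_of_mul_le_mul_right ?_ (mul_pos hkr hk0)
  calc (N₁ : ℝ) * (2 * k) * ((k : ℝ) ^ r * k) = N₁ * (k : ℝ) ^ r * (2 * k ^ 2) := by ring
    _ ≤ k * m.choose r * (k : ℝ) ^ m * (2 * k ^ 2) := by gcongr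
    _ = m.choose r * (k : ℝ) ^ 3 * (2 * (k : ℝ) ^ m) := by ring
    _ ≤ (k : ℝ) ^ r * (2 * (k : ℝ) ^ m) := by gcongr
    _ ≤ (k : ℝ) ^ r * (k * (k : ℝ) ^ m) := by gcongr; linarith
    _ = _ := by ring

end BallsIntoBins

/-! ### Expectations, and potential-function bounds for expected totals. -/

section Mean

variable {α β : Type*}

/-- The expectation of `F` under `p`. -/
def mean (p : PMF α) (F : α → ℝ≥0∞) : ℝ≥0∞ := ∑' a, p a * F a

theorem mean_congr {p : PMF α} {F G : α → ℝ≥0∞} (h : ∀ a ∈ p.support, F a = G a) :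
    mean p F = mean p G := by
  refine tsum_congr fun a => ?_
  by_cases ha : p a = 0
  · simp [ha]
  · rw [h a ((p.mem_support_iff a).2 ha)]

theorem mean_mono {p : PMF α} {F G : α → ℝ≥0∞} (h : ∀ a ∈ p.support, F a ≤ G a) :
    mean p F ≤ mean p G := by
  refine ENNReal.tsum_le_tsum fun a => ?_
  by_cases ha : p a = 0
  · simp [ha]
  · exact mul_le_mul_right (h a ((p.mem_support_iff a).2 ha)) _

theorem mean_add (p : PMF α) (F G : α → ℝ≥0∞) :
    mean p (fun a => F a + G a) = mean p F + mean p G := by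
  simp only [mean, mul_add, ENNReal.tsum_add]

theorem mean_const (p : PMF α) (c : ℝ≥0∞) : mean p (fun _ => c) = c := by
  simp only [mean, ENNReal.tsum_mul_right, p.tsum_coe, one_mul]

theorem mean_const_mul (p : PMF α) (c : ℝ≥0∞) (F : α → ℝ≥0∞) :
    mean p (fun a => c * F a) = c * mean p F := by
  simp only [mean, ← ENNReal.tsum_mul_left]
  exact tsum_congr fun a => by ring

theorem mean_pure (a : α) (F : α → ℝ≥0∞) : mean (PMF.pure a) F = F a := by
  rw [mean, tsum_eq_single a]
  · simp
  · intro b hb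
    simp [PMF.pure_apply, hb]

theorem mean_bind (p : PMF α) (f : α → PMF β) (F : β → ℝ≥0∞) :
    mean (p.bind f) F = mean p fun a => mean (f a) F := by
  simp only [mean, PMF.bind_apply, ← ENNReal.tsum_mul_right, ← ENNReal.tsum_mul_left]
  rw [ENNReal.tsum_comm]
  exact tsum_congr fun a => tsum_congr fun b => by ring

theorem mean_map (p : PMF α) (g : α → β) (F : β → ℝ≥0∞) :
    mean (p.map g) F = mean p (F ∘ g) := by
  rw [PMF.map, mean_bind]
  simp only [Function.comp_apply, mean_pure]
  rfl

theorem mean_uniform_indicator [Fintype α] [Nonempty α] (s : Finset α) :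
    mean (PMF.uniformOfFintype α) (fun a => if a ∈ s then 1 else 0)
      = s.card / Fintype.card α := by
  simp only [mean, PMF.uniformOfFintype_apply, tsum_fintype, ← Finset.mul_sum]
  rw [Finset.sum_boole, div_eq_mul_inv, mul_comm]
  simp

end Mean

variable {n : ℕ}

theorem unscattered_cons (C D : Config n) (l : List (Config n)) :
    Unscattered (C, D :: l) ↔ ¬ Scattered C ∧ Unscattered (D, l) := by
  simp [Unscattered]

theorem mean_execution_succ (A : Algorithm) (adv : Adversary n) (C₀ : Config n) (t : ℕ)
    (F : History n → ℝ≥0∞) :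
    mean (A.execution adv C₀ (t + 1)) F =
      mean (A.execution adv C₀ t) fun h =>
        mean (A.step (adv h) h.1) fun C => F (C, h.1 :: h.2) := by
  rw [Algorithm.execution, mean_bind]
  simp only [mean_map]
  rfl

theorem expectedTotal_eq (A : Algorithm) (adv : Adversary n) (C₀ : Config n)
    (w : History n → ℝ≥0∞) :
    A.expectedTotal adv C₀ w =
      ∑' t, mean (A.execution adv C₀ t) fun h => if Unscattered h then w h else 0 := rfl

/-- A supermartingale bound: a potential that pays for every round bounds the total weight. -/
theorem expectedTotal_le (A : Algorithm) (adv : Adversary n) (C₀ : Config n)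
    (w : History n → ℝ≥0∞) (V : Config n → ℝ≥0∞)
    (hV : ∀ h : History n, ¬ Scattered h.1 →
      w h + mean (A.step (adv h) h.1) (fun C => if Scattered C then 0 else V C) ≤ V h.1) :
    A.expectedTotal adv C₀ w ≤ V C₀ := by
  -- Weight paid so far plus expected potential of the unfinished executions never exceeds the
  -- initial potential.
  have key : ∀ T, ∑ t ∈ Finset.range T,
        mean (A.execution adv C₀ t) (fun h => if Unscattered h then w h else 0)
      + mean (A.execution adv C₀ T) (fun h => if Unscattered h then V h.1 else 0) ≤ V C₀ := by
    intro T
    induction T with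
    | zero =>
      simp only [Finset.range_zero, Finset.sum_empty, zero_add, Algorithm.execution, mean_pure]
      split_ifs <;> simp
    | succ T ih =>
      refine le_trans ?_ ih
      rw [Finset.sum_range_succ, add_assoc]
      gcongr
      rw [mean_execution_succ, ← mean_add]
      refine mean_mono fun h _ => ?_
      by_cases hu : Unscattered h
      · rw [if_pos hu, if_pos hu]
        refine le_trans (le_of_eq ?_) (hV h hu.1)
        congr 2
        funext C
        by_cases hC : Scattered C <;> simp [unscattered_cons, hC, hu]
      · have : ∀ C, ¬ Unscattered (C, h.1 :: h.2) := fun C hC =>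
          hu ((unscattered_cons _ _ _).1 hC).2
        simp [hu, this, mean_const]
  rw [expectedTotal_eq, ENNReal.tsum_eq_iSup_nat]
  exact iSup_le fun T => le_self_add.trans (key T)

/-- If a bounded potential is surely consumed by the weights of the rounds, and scattering is
almost sure, then the expected total weight is at least the initial potential. -/
theorem le_expectedTotal (A : Algorithm) (hA : A.IsScattering) (adv : Adversary n)
    (C₀ : Config n) (w : History n → ℝ≥0∞) (V : Config n → ℝ≥0∞) (b : ℝ≥0∞) (hb : b ≠ ⊤)
    (hVb : ∀ C, V C ≤ b) (hV0 : ∀ C, Scattered C → V C = 0)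
    (hV : ∀ h : History n, ∀ C ∈ (A.step (adv h) h.1).support, V h.1 ≤ w h + V C) :
    V C₀ ≤ A.expectedTotal adv C₀ w := by
  have key : ∀ T, V C₀ ≤ ∑ t ∈ Finset.range T,
        mean (A.execution adv C₀ t) (fun h => if Unscattered h then w h else 0)
      + mean (A.execution adv C₀ T) (fun h => if Unscattered h then V h.1 else 0) := by
    intro T
    induction T with
    | zero =>
      simp only [Finset.range_zero, Finset.sum_empty, zero_add, Algorithm.execution, mean_pure]
      by_cases hC : Scattered C₀ <;> simp [Unscattered, hC, hV0]
    | succ T ih =>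
      refine ih.trans ?_
      rw [Finset.sum_range_succ, add_assoc]
      gcongr
      rw [mean_execution_succ, ← mean_add]
      refine mean_mono fun h _ => ?_
      by_cases hu : Unscattered h
      · rw [if_pos hu, if_pos hu]
        have h1 : V h.1 = mean (A.step (adv h) h.1) fun _ => V h.1 := (mean_const _ _).symm
        rw [h1, ← mean_const (A.step (adv h) h.1) (w h), ← mean_add]
        refine mean_mono fun C hC => (hV h C hC).trans ?_
        by_cases hs : Scattered C
        · simp [hV0 C hs]
        · simp [unscattered_cons, hs, hu]
      · simp [hu]
  -- The potential left after `T` rounds is at most `b` times the probability of being still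
  -- unscattered, which vanishes.
  have hlim : Tendsto (fun T => A.expectedTotal adv C₀ w + b *
      mean (A.execution adv C₀ T) (fun h => if Unscattered h then 1 else 0)) atTop
      (𝓝 (A.expectedTotal adv C₀ w + b * 0)) :=
    tendsto_const_nhds.add (ENNReal.Tendsto.const_mul (hA n adv C₀) (Or.inr hb))
  rw [mul_zero, add_zero] at hlim
  refine ge_of_tendsto' hlim fun T => (key T).trans ?_
  gcongr
  · rw [expectedTotal_eq]
    exact ENNReal.sum_le_tsum _
  · rw [← mean_const_mul]
    refine mean_mono fun h _ => ?_
    split_ifs <;> simp [hVb]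

theorem first_round_le_expectedTotal (A : Algorithm) (adv : Adversary n) (C₀ : Config n)
    (w : History n → ℝ≥0∞) (h : ¬ Scattered C₀) :
    w (C₀, []) ≤ A.expectedTotal adv C₀ w := by
  rw [expectedTotal_eq]
  refine le_trans ?_ (ENNReal.le_tsum 0)
  simp [Algorithm.execution, mean_pure, Unscattered, h]

/-- The expected number of rounds is the sum over `t` of the probability of being unscattered after
`t` rounds; the terms of a convergent series tend to `0`. -/
theorem isScattering_of_rounds_ne_top (A : Algorithm) (h : ∀ n, A.rounds n ≠ ⊤) :
    A.IsScattering := by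
  intro n adv C₀
  refine ENNReal.tendsto_atTop_zero_of_tsum_ne_top (ne_top_of_le_ne_top (h n) ?_)
  exact le_iSup₂_of_le (f := fun (adv : Adversary n) (C₀ : Config n) =>
    A.expectedTotal adv C₀ fun _ => 1) adv C₀ le_rfl

theorem mem_destinations_of_mem_support_step {A : Algorithm} {φ : Plane → Frame}
    {C D : Config n} (hD : D ∈ (A.step φ C).support) (i : Fin n) :
    D i ∈ A.destinations (φ (C i)) C (C i) := by
  rw [Algorithm.step, PMF.mem_support_map_iff] at hD
  obtain ⟨c, -, rfl⟩ := hD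
  exact Multiset.coe_mem

/-! ### Occupied points and coordinate frames. -/

/-- The set of occupied points. -/
def occ (C : Config n) : Finset Plane := Finset.univ.image C

theorem mem_occ {C : Config n} {P : Plane} : P ∈ occ C ↔ ∃ i, C i = P := by simp [occ]

theorem occ_card_le (C : Config n) : (occ C).card ≤ n := by
  simpa [occ] using Finset.card_image_le (s := Finset.univ) (f := C)

theorem scattered_iff_card_occ {C : Config n} : Scattered C ↔ (occ C).card = n := by
  have := Finset.card_image_iff (s := Finset.univ) (f := C)
  simpa [Scattered, occ] using this.symm

theorem occ_card_pos (hn : 0 < n) (C : Config n) : 0 < (occ C).card :=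
  Finset.card_pos.2 ⟨C ⟨0, hn⟩, mem_occ.2 ⟨_, rfl⟩⟩

theorem Frame.toGlobal_toLocal (φ : Frame) (P Q : Plane) : φ.toGlobal P (φ.toLocal P Q) = Q := by
  simp [Frame.toGlobal, Frame.toLocal, smul_smul, inv_mul_cancel₀ φ.scale_pos.ne']

theorem Frame.toLocal_toGlobal (φ : Frame) (P X : Plane) : φ.toLocal P (φ.toGlobal P X) = X := by
  simp [Frame.toGlobal, Frame.toLocal, smul_smul, mul_inv_cancel₀ φ.scale_pos.ne']

theorem Frame.toLocal_injective (φ : Frame) (P : Plane) : Function.Injective (φ.toLocal P) :=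
  Function.LeftInverse.injective (φ.toGlobal_toLocal P)

theorem Frame.toGlobal_injective (φ : Frame) (P : Plane) : Function.Injective (φ.toGlobal P) :=
  Function.LeftInverse.injective (φ.toLocal_toGlobal P)

theorem Frame.toLocal_self (φ : Frame) (P : Plane) : φ.toLocal P P = 0 := by
  simp [Frame.toLocal]

theorem Frame.dist_toLocal (φ : Frame) (P Q R : Plane) :
    dist (φ.toLocal P Q) (φ.toLocal P R) = φ.scale * dist Q R := by
  simp only [Frame.toLocal, dist_eq_norm, ← smul_sub, ← map_sub, norm_smul,
    LinearIsometryEquiv.norm_map, Real.norm_eq_abs, abs_of_pos φ.scale_pos]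
  congr 2
  abel

theorem card_destinations (A : Algorithm) (φ : Frame) (C : Config n) (P : Plane) :
    Multiset.card (A.destinations φ C P) = Multiset.card (A.dest (localSnapshot φ C P)) := by
  simp [Algorithm.destinations]

theorem one_le_card_destinations (A : Algorithm) (φ : Frame) (C : Config n) (P : Plane) :
    1 ≤ Multiset.card (A.destinations φ C P) :=
  Multiset.card_pos.2 (A.destinations_ne_zero φ C P)

/-! ### Entropy and the lower bound on random bits. -/

theorem sum_inv_card_fiber {ι κ : Type*} [DecidableEq κ] (G : Finset ι) (g : ι → κ) :
    ∑ i ∈ G, ((G.filter fun j => g j = g i).card : ℝ)⁻¹ = (G.image g).card := by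
  rw [← Finset.sum_fiberwise_of_maps_to (t := G.image g) (g := g)
    fun i hi => Finset.mem_image_of_mem g hi]
  rw [Finset.card_eq_sum_ones, Nat.cast_sum]
  refine Finset.sum_congr rfl fun P hP => ?_
  obtain ⟨i, hi, rfl⟩ := Finset.mem_image.1 hP
  have : ∀ j ∈ G.filter (fun j => g j = g i), ((G.filter fun l => g l = g j).card : ℝ)⁻¹
      = ((G.filter fun l => g l = g i).card : ℝ)⁻¹ := by
    intro j hj
    rw [(Finset.mem_filter.1 hj).2]
  rw [Finset.sum_congr rfl this, Finset.sum_const, nsmul_eq_mul, Nat.cast_one]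
  refine mul_inv_cancel₀ (Nat.cast_ne_zero.2 (Finset.card_pos.2 ⟨i, ?_⟩).ne')
  simp [hi]

/-- A group that spreads over at most `k` places keeps at least its entropy minus `log k` per
member. -/
theorem card_mul_logb_card_le {ι κ : Type*} [DecidableEq κ] (G : Finset ι) (g : ι → κ) (k : ℕ)
    (hk : (G.image g).card ≤ k) (hk1 : 1 ≤ k) :
    ∑ _i ∈ G, Real.logb 2 G.card ≤ ∑ _i ∈ G, Real.logb 2 k
      + ∑ i ∈ G, Real.logb 2 (G.filter fun j => g j = g i).card := by
  have hk0 : (0 : ℝ) < k := by exact_mod_cast hk1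
  have hl2 : 0 < Real.log 2 := Real.log_pos (by norm_num)
  rw [← sub_nonpos, ← Finset.sum_add_distrib, ← Finset.sum_sub_distrib]
  -- `log z ≤ z - 1` at `z = |G| / (k |fiber|)`. The inverse fiber sizes sum to the number of
  -- fibers, at most `k`, so the right-hand sides sum to at most `0`.
  have hterm : ∀ i ∈ G, Real.logb 2 G.card
      - (Real.logb 2 k + Real.logb 2 (G.filter fun j => g j = g i).card)
      ≤ (G.card / k * ((G.filter fun j => g j = g i).card : ℝ)⁻¹ - 1) / Real.log 2 := by
    intro i hi
    have hG : (0 : ℝ) < G.card := by exact_mod_cast Finset.card_pos.2 ⟨i, hi⟩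
    have hF : (0 : ℝ) < (G.filter fun j => g j = g i).card := by
      exact_mod_cast Finset.card_pos.2 ⟨i, by simp [hi]⟩
    have := Real.log_le_sub_one_of_pos
      (show 0 < G.card / k * ((G.filter fun j => g j = g i).card : ℝ)⁻¹ by positivity)
    rw [Real.log_mul (by positivity) (by positivity), Real.log_div hG.ne' hk0.ne',
      Real.log_inv] at this
    simp only [Real.logb]
    rw [← add_div, ← sub_div]
    exact div_le_div_of_nonneg_right (by linarith) hl2.le
  refine (Finset.sum_le_sum hterm).trans ?_
  rw [← Finset.sum_div, Finset.sum_sub_distrib, ← Finset.mul_sum, sum_inv_card_fiber]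
  refine div_nonpos_of_nonpos_of_nonneg ?_ hl2.le
  simp only [Finset.sum_const, nsmul_eq_mul, mul_one, sub_nonpos]
  have : ((G.image g).card : ℝ) ≤ k := by exact_mod_cast hk
  calc (G.card : ℝ) / k * (G.image g).card ≤ G.card / k * k := by gcongr
    _ = G.card := by field_simp

/-- The number of bits that are needed to scatter a configuration. -/
def entropy (C : Config n) : ℝ := ∑ i, Real.logb 2 (multiplicity C (C i))

theorem multiplicity_pos (C : Config n) (i : Fin n) : 1 ≤ multiplicity C (C i) :=
  Finset.card_pos.2 ⟨i, by simp⟩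

theorem entropy_le (C : Config n) : entropy C ≤ nLog n := by
  have : ∀ i ∈ (Finset.univ : Finset (Fin n)),
      Real.logb 2 (multiplicity C (C i)) ≤ Real.logb 2 n := by
    intro i _
    refine Real.logb_le_logb_of_le (by norm_num) (by exact_mod_cast multiplicity_pos C i) ?_
    exact_mod_cast (Finset.card_le_univ _).trans (by simp)
  simpa [entropy, nLog] using Finset.sum_le_sum this

theorem multiplicity_of_scattered {C : Config n} (h : Scattered C) (i : Fin n) :
    multiplicity C (C i) = 1 := by
  rw [multiplicity, Finset.card_eq_one]
  exact ⟨i, by ext j; simp [h.eq_iff]⟩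

theorem entropy_scattered {C : Config n} (h : Scattered C) : entropy C = 0 := by
  simp [entropy, multiplicity_of_scattered h]

theorem card_image_group_le {A : Algorithm} {φ : Plane → Frame} {C D : Config n}
    (hD : D ∈ (A.step φ C).support) (P : Plane) :
    ((Finset.univ.filter fun i => C i = P).image D).card
      ≤ Multiset.card (A.destinations (φ P) C P) := by
  refine (Finset.card_le_card (t := (A.destinations (φ P) C P).toFinset) ?_).trans
    (Multiset.toFinset_card_le _)
  intro Q hQ
  obtain ⟨i, hi, rfl⟩ := Finset.mem_image.1 hQ
  have hi' : C i = P := by simpa using hi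
  rw [Multiset.mem_toFinset, ← hi']
  exact mem_destinations_of_mem_support_step hD i

/-- Each group is treated on its own by `card_mul_logb_card_le`. The inequality holds for every
outcome of the round, not merely on average. -/
theorem entropy_le_roundBits_add {A : Algorithm} {φ : Plane → Frame} {C D : Config n}
    (hD : D ∈ (A.step φ C).support) :
    ENNReal.ofReal (entropy C) ≤ A.roundBits φ C + ENNReal.ofReal (entropy D) := by
  have hpos : ∀ i : Fin n, 0 ≤ if 2 ≤ multiplicity C (C i) then
      Real.logb 2 (Multiset.card (A.destinations (φ (C i)) C (C i))) else 0 := by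
    intro i
    split_ifs
    · exact Real.logb_nonneg (by norm_num)
        (by exact_mod_cast one_le_card_destinations A (φ (C i)) C (C i))
    · exact le_rfl
  have hbits : A.roundBits φ C = ENNReal.ofReal (∑ i, if 2 ≤ multiplicity C (C i) then
      Real.logb 2 (Multiset.card (A.destinations (φ (C i)) C (C i))) else 0) := by
    rw [ENNReal.ofReal_sum_of_nonneg fun i _ => hpos i, Algorithm.roundBits]
    refine Finset.sum_congr rfl fun i _ => ?_
    split_ifs <;> simp
  have hent : 0 ≤ entropy D := Finset.sum_nonneg fun i _ =>
    Real.logb_nonneg (by norm_num) (by exact_mod_cast multiplicity_pos D i)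
  rw [hbits, ← ENNReal.ofReal_add (Finset.sum_nonneg fun i _ => hpos i) hent]
  refine ENNReal.ofReal_le_ofReal ?_
  have hmaps : ∀ i ∈ (Finset.univ : Finset (Fin n)), C i ∈ occ C := fun i _ => mem_occ.2 ⟨i, rfl⟩
  simp only [entropy]
  rw [← Finset.sum_fiberwise_of_maps_to hmaps, ← Finset.sum_fiberwise_of_maps_to hmaps,
    ← Finset.sum_fiberwise_of_maps_to hmaps, ← Finset.sum_add_distrib]
  refine Finset.sum_le_sum fun P _ => ?_
  set G := Finset.univ.filter fun i => C i = P with hG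
  have hCP : ∀ i ∈ G, C i = P := fun i hi => by simpa [hG] using hi
  -- Members of other groups may arrive at the same place; this only raises the entropy.
  have hmon : ∑ i ∈ G, Real.logb 2 (G.filter fun j => D j = D i).card
      ≤ ∑ i ∈ G, Real.logb 2 (multiplicity D (D i)) := by
    refine Finset.sum_le_sum fun i hi => Real.logb_le_logb_of_le (by norm_num) ?_ ?_
    · exact_mod_cast Finset.card_pos.2 ⟨i, by simp [hi]⟩
    · exact_mod_cast Finset.card_le_card (Finset.filter_subset_filter _ (Finset.subset_univ _))
  have hl : ∑ i ∈ G, Real.logb 2 (multiplicity C (C i)) = ∑ _i ∈ G, Real.logb 2 G.card :=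
    Finset.sum_congr rfl fun i hi => by rw [hCP i hi]; rfl
  rw [hl]
  by_cases h2 : 2 ≤ G.card
  · have hm : ∑ i ∈ G, (if 2 ≤ multiplicity C (C i) then
        Real.logb 2 (Multiset.card (A.destinations (φ (C i)) C (C i))) else 0)
        = ∑ _i ∈ G, Real.logb 2 (Multiset.card (A.destinations (φ P) C P)) := by
      refine Finset.sum_congr rfl fun i hi => ?_
      rw [hCP i hi]
      exact if_pos h2
    rw [hm]
    exact (card_mul_logb_card_le G D _ (card_image_group_le hD P)
      (one_le_card_destinations _ _ _ _)).trans (add_le_add le_rfl hmon)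
  -- A lone robot has entropy `0`, so it does not matter that its bits are not counted.
  · have h0 : ∑ _i ∈ G, Real.logb 2 G.card = 0 := by
      have : G.card = 0 ∨ G.card = 1 := by omega
      rcases this with h | h <;> simp [h]
    rw [h0]
    exact add_nonneg (Finset.sum_nonneg fun i _ => hpos i) (Finset.sum_nonneg fun i _ =>
      Real.logb_nonneg (by norm_num) (by exact_mod_cast multiplicity_pos D i))

/-- Scattering `n` gathered robots takes `n log n` random bits. -/
theorem nLog_le_bits (B : Algorithm) (hB : B.IsScattering) (n : ℕ) :
    ENNReal.ofReal (nLog n) ≤ B.bits n := by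
  let adv : Adversary n := fun _ _ => ⟨LinearIsometryEquiv.refl ℝ Plane, 1, one_pos⟩
  let C₀ : Config n := fun _ => 0
  have h0 : entropy C₀ = nLog n := by simp [entropy, nLog, multiplicity, C₀]
  rw [← h0]
  refine le_iSup₂_of_le adv C₀ ?_
  refine le_expectedTotal B hB adv C₀ _ (fun C => ENNReal.ofReal (entropy C))
    (ENNReal.ofReal (nLog n)) ENNReal.ofReal_ne_top
    (fun C => ENNReal.ofReal_le_ofReal (entropy_le C)) ?_ ?_
  · intro C hC
    simp [entropy_scattered hC]
  · intro h C hC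
    exact entropy_le_roundBits_add hC

/-! ### Weak multiplicity detection and the lower bound on time. -/

theorem exists_config_map_eq (T : Multiset Plane) :
    ∃ C : Config (Multiset.card T), Finset.univ.val.map C = T := by
  obtain ⟨l, rfl⟩ : ∃ l : List Plane, (l : Multiset Plane) = T := Quot.exists_rep T
  exact ⟨l.get, (Fin.univ_val_map l.get).trans (congrArg _ (List.ofFn_get l))⟩

theorem multiplicity_eq_count (C : Config n) (P : Plane) :
    multiplicity C P = (Finset.univ.val.map C).count P := by
  rw [Multiset.count_map, multiplicity, Finset.card_def, Finset.filter_val]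
  simp only [eq_comm]

theorem mem_occ_iff_mem_map {C : Config n} {P : Plane} :
    P ∈ occ C ↔ P ∈ Finset.univ.val.map C := by
  simp [occ]

theorem localSnapshot_eq (φ : Frame) (C : Config n) (P : Plane) :
    localSnapshot φ C P = (Finset.univ.val.map C).map (φ.toLocal P) := by
  rw [localSnapshot, Multiset.map_map]
  rfl

theorem mem_localSnapshot_iff (φ : Frame) (C : Config n) (P X : Plane) :
    X ∈ localSnapshot φ C P ↔ φ.toGlobal P X ∈ occ C := by
  rw [← φ.toLocal_toGlobal P X, localSnapshot_eq,
    Multiset.mem_map_of_injective (φ.toLocal_injective P), φ.toLocal_toGlobal P X,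
    mem_occ_iff_mem_map]

theorem count_localSnapshot (φ : Frame) (C : Config n) (P X : Plane) :
    (localSnapshot φ C P).count X = multiplicity C (φ.toGlobal P X) := by
  conv_lhs => rw [← φ.toLocal_toGlobal P X]
  rw [localSnapshot_eq, Multiset.count_map_eq_count' _ _ (φ.toLocal_injective P),
    multiplicity_eq_count]

/-- The two configurations may have different numbers of robots, which is what the lower bound on
time exploits. -/
theorem Algorithm.GlobalWeakDetection.dest_eq {B : Algorithm} (hB : B.GlobalWeakDetection)
    {n' : ℕ} {C : Config n} {C' : Config n'} (hocc : ∀ Q, Q ∈ occ C ↔ Q ∈ occ C')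
    (hmult : ∀ Q, 1 < multiplicity C Q ↔ 1 < multiplicity C' Q) (φ : Frame) (P : Plane) :
    B.dest (localSnapshot φ C P) = B.dest (localSnapshot φ C' P) := by
  refine hB _ _ (fun X => ?_) (fun X => ?_)
  · rw [mem_localSnapshot_iff, mem_localSnapshot_iff, hocc]
  · have h1 := count_localSnapshot φ C P X
    have h2 := count_localSnapshot φ C' P X
    have := hmult (φ.toGlobal P X)
    rw [← h1, ← h2] at this
    convert this

/-- A weak snapshot with `u` occupied points is shared by a configuration with few robots most of
which are located at a given point of multiplicity. -/
theorem exists_weakly_equivalent_config (C : Config n) (P : Plane) (hP : 2 ≤ multiplicity C P)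
    (r : ℕ) : ∃ (n' : ℕ) (C' : Config n'), r ≤ n' ∧ n' ≤ 2 * (occ C).card + r ∧
      r ≤ multiplicity C' P ∧ (∀ Q, Q ∈ occ C ↔ Q ∈ occ C') ∧
      ∀ Q, 1 < multiplicity C Q ↔ 1 < multiplicity C' Q := by
  set M := (occ C).filter fun Q => 2 ≤ multiplicity C Q with hM
  -- One robot at every occupied point, a second one at every point of multiplicity, and `r` more at
  -- `P`.
  obtain ⟨C', hC'⟩ := exists_config_map_eq ((occ C).val + M.val + Multiset.replicate r P)
  have hPocc : ∀ Q, 0 < multiplicity C Q ↔ Q ∈ occ C := fun Q => by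
    rw [multiplicity_eq_count, Multiset.count_pos, mem_occ_iff_mem_map]
  have hcount : ∀ Q, multiplicity C' Q = (if Q ∈ occ C then 1 else 0) +
      (if Q ∈ M then 1 else 0) + if P = Q then r else 0 := by
    intro Q
    rw [multiplicity_eq_count, hC', Multiset.count_add, Multiset.count_add,
      Multiset.count_replicate, Multiset.count_eq_of_nodup (occ C).nodup,
      Multiset.count_eq_of_nodup M.nodup]
    rfl
  have hPo : P ∈ occ C := (hPocc P).1 (by omega)
  have hcardM : M.card ≤ (occ C).card := Finset.card_filter_le _ _
  refine ⟨_, C', ?_, ?_, ?_, ?_, ?_⟩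
  · simp
  · simp only [Multiset.card_add, Multiset.card_replicate, Finset.card_val]
    omega
  · rw [hcount P, if_pos rfl]
    omega
  · intro Q
    rw [mem_occ_iff_mem_map (C := C'), hC', Multiset.mem_add, Multiset.mem_add,
      Multiset.mem_replicate]
    simp only [Finset.mem_val]
    constructor
    · exact fun h => Or.inl (Or.inl h)
    · rintro ((h | h) | ⟨-, rfl⟩)
      · exact h
      · exact (Finset.mem_filter.1 h).1
      · exact hPo
  · intro Q
    have h1 := hPocc Q
    have hMQ : Q ∈ M ↔ 2 ≤ multiplicity C Q := by
      rw [hM, Finset.mem_filter, ← h1]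
      omega
    rw [hcount Q]
    by_cases hQ : 2 ≤ multiplicity C Q
    · rw [if_pos (hMQ.2 hQ), if_pos (h1.1 (by omega))]
      omega
    · have hne : P ≠ Q := fun h => hQ (h ▸ hP)
      rw [if_neg (fun h => hQ (hMQ.1 h)), if_neg hne]
      split_ifs <;> omega

/-- Random bit optimality bounds the number of destinations by a polynomial in the number of
occupied points. -/
theorem card_destinations_le_of_bits_le {B : Algorithm} (hB : B.GlobalWeakDetection) {c : ℝ}
    (hc : 0 < c) {n₀ : ℕ} (hbits : ∀ m ≥ n₀, B.bits m ≤ ENNReal.ofReal (c * nLog m))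
    (C : Config n) (φ : Frame) (P : Plane) (hP : 2 ≤ multiplicity C P) :
    Multiset.card (B.destinations φ C P) ≤ ((4 + 2 * n₀) * (occ C).card) ^ ⌈2 * c⌉₊ := by
  set u := (occ C).card with hu
  have hPo : P ∈ occ C := by
    rw [mem_occ_iff_mem_map, ← Multiset.count_pos, ← multiplicity_eq_count]
    omega
  have hu1 : 1 ≤ u := Finset.card_pos.2 ⟨P, hPo⟩
  -- The summand `2 * u` puts at least half of the `n' ≤ 2 * u + r ≤ 2 * r` robots at `P`; the
  -- summand `n₀` makes the bit bound applicable to `n'`.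
  set r := 2 * u + n₀ with hr
  obtain ⟨n', C', hrn, hn', hrP, hocc, hmult⟩ := exists_weakly_equivalent_config C P hP r
  set k := Multiset.card (B.destinations φ C P) with hk
  have hk' : k = Multiset.card (B.destinations φ C' P) := by
    rw [hk, card_destinations, card_destinations, hB.dest_eq hocc hmult]
  have hk1 : 1 ≤ k := one_le_card_destinations B φ C P
  have hns : ¬ Scattered C' := by
    intro h
    obtain ⟨i, rfl⟩ := mem_occ.1 ((hocc P).1 hPo)
    have := multiplicity_of_scattered h i
    omega
  have hround : (r : ℝ≥0∞) * ENNReal.ofReal (Real.logb 2 k) ≤ B.roundBits (fun _ => φ) C' := by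
    calc (r : ℝ≥0∞) * ENNReal.ofReal (Real.logb 2 k)
        ≤ (multiplicity C' P : ℝ≥0∞) * ENNReal.ofReal (Real.logb 2 k) := by gcongr
      _ = ∑ i ∈ Finset.univ.filter (fun i => C' i = P), ENNReal.ofReal (Real.logb 2 k) := by
          rw [Finset.sum_const, nsmul_eq_mul, multiplicity]
      _ = ∑ i ∈ Finset.univ.filter (fun i => C' i = P), (if 2 ≤ multiplicity C' (C' i) then
            ENNReal.ofReal (Real.logb 2 (Multiset.card (B.destinations φ C' (C' i)))) else 0) := by
          refine Finset.sum_congr rfl fun i hi => ?_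
          have hi' : C' i = P := by simpa using hi
          rw [hi', if_pos (by omega), ← hk']
      _ ≤ _ := Finset.sum_le_sum_of_subset (Finset.subset_univ _)
  have htotal : B.roundBits (fun _ => φ) C' ≤ B.bits n' := by
    refine (first_round_le_expectedTotal B (fun _ _ => φ) C'
      (fun h => B.roundBits (fun _ => φ) h.1) hns).trans ?_
    exact le_iSup₂_of_le (f := fun (adv : Adversary n') (C₀ : Config n') =>
      B.expectedTotal adv C₀ fun h => B.roundBits (adv h) h.1) (fun _ _ => φ) C' le_rfl
  have hreal : (r : ℝ) * Real.logb 2 k ≤ c * nLog n' := by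
    have h := hround.trans (htotal.trans (hbits n' (by omega)))
    rw [← ENNReal.ofReal_natCast r, ← ENNReal.ofReal_mul (Nat.cast_nonneg r)] at h
    refine (ENNReal.ofReal_le_ofReal_iff ?_).1 h
    refine mul_nonneg hc.le (mul_nonneg (Nat.cast_nonneg _) (Real.logb_nonneg (by norm_num) ?_))
    exact_mod_cast (by omega : 1 ≤ n')
  have hr0 : (0 : ℝ) < r := by exact_mod_cast (by omega : 0 < r)
  have hn0 : (0 : ℝ) < n' := by exact_mod_cast (by omega : 0 < n')
  have h2r : (n' : ℝ) ≤ 2 * r := by exact_mod_cast (by omega : n' ≤ 2 * r)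
  have hlog0 : 0 ≤ Real.logb 2 (2 * r) := Real.logb_nonneg (by norm_num)
    (by exact_mod_cast (by omega : 1 ≤ 2 * r))
  -- The first round costs at least `r log k` bits, and at most `c n' log n'` with `n' ≤ 2 * r` is
  -- available.
  have hlog : Real.logb 2 k ≤ ⌈2 * c⌉₊ * Real.logb 2 (2 * r) := by
    refine le_of_mul_le_mul_left ?_ hr0
    calc (r : ℝ) * Real.logb 2 k ≤ c * (n' * Real.logb 2 n') := hreal
      _ ≤ c * ((2 * r) * Real.logb 2 (2 * r)) := by
          have : Real.logb 2 n' ≤ Real.logb 2 (2 * r) :=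
            Real.logb_le_logb_of_le (by norm_num) hn0 h2r
          have h0 : 0 ≤ Real.logb 2 n' := Real.logb_nonneg (by norm_num)
            (by exact_mod_cast (by omega : 1 ≤ n'))
          exact mul_le_mul_of_nonneg_left (mul_le_mul h2r this h0 (by positivity)) hc.le
      _ = r * ((2 * c) * Real.logb 2 (2 * r)) := by ring
      _ ≤ _ := by gcongr; exact Nat.le_ceil _
  have hkr : (k : ℝ) ≤ (2 * r) ^ ⌈2 * c⌉₊ := by
    rw [← Real.logb_pow] at hlog
    exact (Real.logb_le_logb (by norm_num) (by exact_mod_cast hk1) (by positivity)).1 hlog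
  have hkr' : k ≤ (2 * r) ^ ⌈2 * c⌉₊ := by exact_mod_cast hkr
  refine hkr'.trans (Nat.pow_le_pow_left ?_ _)
  rw [hr]
  nlinarith

theorem card_occ_step_le {B : Algorithm} {φ : Plane → Frame} {C D : Config n}
    (hD : D ∈ (B.step φ C).support) {K : ℕ} (hK : 1 ≤ K)
    (hC : ∀ P, 2 ≤ multiplicity C P → Multiset.card (B.destinations (φ P) C P) ≤ K) :
    (occ D).card ≤ (occ C).card * K := by
  have hsub : occ D ⊆ (occ C).biUnion fun P =>
      (Finset.univ.filter fun i => C i = P).image D := by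
    intro Q hQ
    obtain ⟨i, rfl⟩ := mem_occ.1 hQ
    exact Finset.mem_biUnion.2 ⟨C i, mem_occ.2 ⟨i, rfl⟩, Finset.mem_image.2 ⟨i, by simp, rfl⟩⟩
  refine (Finset.card_le_card hsub).trans (Finset.card_biUnion_le_card_mul _ _ _ fun P _ => ?_)
  by_cases hP : 2 ≤ multiplicity C P
  · exact (card_image_group_le hD P).trans (hC P hP)
  · refine Finset.card_image_le.trans (le_trans ?_ hK)
    have : multiplicity C P ≤ 1 := by omega
    exact this

/-- If the number of occupied points grows at most polynomially in each round, then it is at most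
doubly exponential in the number of rounds. -/
theorem card_occ_execution_le {B : Algorithm} {E d : ℕ} (hE : 1 ≤ E) (hn : 0 < n)
    (hB : ∀ (φ : Plane → Frame) (C : Config n) (P : Plane), 2 ≤ multiplicity C P →
      Multiset.card (B.destinations (φ P) C P) ≤ (E * (occ C).card) ^ d)
    (adv : Adversary n) (t : ℕ) :
    ∀ h ∈ (B.execution adv (fun _ => 0) t).support, ∀ C ∈ h.1 :: h.2,
      E * (occ C).card ≤ E ^ (d + 2) ^ t := by
  induction t with
  | zero =>
    intro h hh C hC
    rw [Algorithm.execution, PMF.support_pure, Set.mem_singleton_iff] at hh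
    subst hh
    have hC' : C = fun _ => 0 := by simpa using hC
    have : (occ C).card ≤ 1 := by
      rw [Finset.card_le_one, hC']
      intro a ha b hb
      obtain ⟨_, rfl⟩ := mem_occ.1 ha
      obtain ⟨_, rfl⟩ := mem_occ.1 hb
      rfl
    simpa using Nat.mul_le_mul_left E this
  | succ t ih =>
    intro h hh C hC
    rw [Algorithm.execution, PMF.mem_support_bind_iff] at hh
    obtain ⟨g, hg, hh⟩ := hh
    rw [PMF.mem_support_map_iff] at hh
    obtain ⟨D, hD, rfl⟩ := hh
    have hmono : E ^ (d + 2) ^ t ≤ E ^ (d + 2) ^ (t + 1) :=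
      Nat.pow_le_pow_right hE (Nat.pow_le_pow_right (by omega) (by omega))
    rcases List.mem_cons.1 hC with rfl | hC
    · have hu1 : 1 ≤ E * (occ g.1).card := Nat.mul_pos hE (occ_card_pos hn _)
      have h1 := card_occ_step_le hD (Nat.one_le_pow d _ hu1) (hB (adv g) g.1)
      have h2 := ih g hg g.1 List.mem_cons_self
      -- Carrying the factor `E` turns the recursion into `v ↦ v ^ (d + 1)` for `v = E * u`; the
      -- exponent `d + 2` has slack.
      calc E * (occ C).card
          ≤ E * ((occ g.1).card * (E * (occ g.1).card) ^ d) := Nat.mul_le_mul_left _ h1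
        _ = (E * (occ g.1).card) ^ (d + 1) := by ring
        _ ≤ (E * (occ g.1).card) ^ (d + 2) := Nat.pow_le_pow_right hu1 (by omega)
        _ ≤ (E ^ (d + 2) ^ t) ^ (d + 2) := Nat.pow_le_pow_left h2 _
        _ = _ := by rw [← pow_mul, pow_succ (d + 2) t]
    · exact (ih g hg C hC).trans hmono

theorem le_rounds_of_unscattered {B : Algorithm} {adv : Adversary n} {C₀ : Config n} {T : ℕ}
    (h : ∀ t < T, ∀ h ∈ (B.execution adv C₀ t).support, Unscattered h) :
    (T : ℝ≥0∞) ≤ B.rounds n := by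
  refine le_trans ?_ (le_iSup₂_of_le (f := fun (adv : Adversary n) (C₀ : Config n) =>
    B.expectedTotal adv C₀ fun _ => 1) adv C₀ le_rfl)
  rw [expectedTotal_eq]
  refine le_trans (le_of_eq ?_) (ENNReal.sum_le_tsum (Finset.range T))
  rw [Finset.sum_congr rfl (g := fun _ => (1 : ℝ≥0∞)), Finset.sum_const, Finset.card_range,
    nsmul_one]
  intro t ht
  rw [mean_congr (G := fun _ => 1) fun g hg => if_pos (h t (Finset.mem_range.1 ht) g hg),
    mean_const]

theorem tendsto_logLog : Tendsto logLog atTop atTop := by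
  have h := Real.tendsto_logb_atTop (b := 2) (by norm_num)
  exact h.comp (h.comp tendsto_natCast_atTop_atTop)

/-- Random bit optimal algorithms with weak multiplicity detection need `Ω(log log n)` rounds. -/
theorem rounds_isBigOmega {B : Algorithm} (hB : B.GlobalWeakDetection)
    (hbits : IsBigO B.bits nLog) : IsBigOmega B.rounds logLog := by
  obtain ⟨c, hc, hev⟩ := hbits
  obtain ⟨n₀, hn₀⟩ := eventually_atTop.1 hev
  set E := 4 + 2 * n₀ with hE
  set d := ⌈2 * c⌉₊ with hd
  set q := d + 2 with hq
  have hqpos : (0 : ℝ) < q := by positivity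
  -- The argument yields `(log log n - E) / q` rounds; the factor `2` absorbs `E` once `log log n ≥
  -- 2 * E`.
  refine ⟨1 / (2 * q), by positivity, ?_⟩
  filter_upwards [tendsto_logLog.eventually_ge_atTop (2 * E), eventually_ge_atTop 3] with n hn hn3
  have hn0 : 0 < n := by omega
  set T := ⌈(logLog n - E) / q⌉₊ with hT
  have hrounds : (T : ℝ≥0∞) ≤ B.rounds n := by
    refine le_rounds_of_unscattered (adv := fun _ _ => ⟨LinearIsometryEquiv.refl ℝ Plane, 1, one_pos⟩)
      (C₀ := fun _ => 0) fun t ht h hh => ?_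
    have hlt : (t : ℝ) < (logLog n - E) / q := Nat.lt_ceil.1 ht
    rw [lt_div_iff₀ hqpos] at hlt
    -- `E ^ q ^ t ≤ 2 ^ 2 ^ (E + t * q)`, and `E + t * q < log log n`.
    have hsmall : E ^ q ^ t < n := by
      have hlog1 : 0 < Real.logb 2 n := Real.logb_pos (by norm_num) (by exact_mod_cast (by omega : 1 < n))
      have h1 : (2 : ℝ) ^ ((E + t * q : ℕ) : ℝ) < Real.logb 2 n := by
        refine (Real.lt_logb_iff_rpow_lt (by norm_num) hlog1).1 ?_
        have : ((E + t * q : ℕ) : ℝ) < logLog n := by push_cast; linarith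
        exact this
      have h2 : (2 : ℝ) ^ ((2 : ℝ) ^ ((E + t * q : ℕ) : ℝ)) < n :=
        (Real.lt_logb_iff_rpow_lt (by norm_num) (by exact_mod_cast hn0)).1 h1
      have h3 : 2 ^ 2 ^ (E + t * q) < n := by
        rw [Real.rpow_natCast] at h2
        have : ((2 : ℝ) ^ (E + t * q)) = ((2 ^ (E + t * q) : ℕ) : ℝ) := by push_cast; rfl
        rw [this, Real.rpow_natCast] at h2
        exact_mod_cast h2
      refine lt_of_le_of_lt ?_ h3
      calc E ^ q ^ t ≤ (2 ^ E) ^ q ^ t := Nat.pow_le_pow_left Nat.lt_two_pow_self.le _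
        _ = 2 ^ (E * q ^ t) := by rw [pow_mul]
        _ ≤ 2 ^ (2 ^ E * (2 ^ q) ^ t) := by
            refine Nat.pow_le_pow_right (by norm_num) (Nat.mul_le_mul Nat.lt_two_pow_self.le ?_)
            exact Nat.pow_le_pow_left Nat.lt_two_pow_self.le _
        _ = _ := by rw [← pow_mul, ← pow_add, mul_comm q t]
    have hall := card_occ_execution_le (B := B) (E := E) (d := d) (by omega) hn0
      (fun φ C P hP => card_destinations_le_of_bits_le hB hc hn₀ C (φ P) P hP) _ t h hh
    have hns : ∀ C ∈ h.1 :: h.2, ¬ Scattered C := by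
      intro C hC hs
      have h1 := hall C hC
      rw [scattered_iff_card_occ.1 hs] at h1
      have : n ≤ E * n := Nat.le_mul_of_pos_left n (by omega)
      exact absurd (this.trans h1) (not_le.2 hsmall)
    exact ⟨hns _ List.mem_cons_self, fun C hC => hns C (List.mem_cons_of_mem _ hC)⟩
  refine le_trans ?_ hrounds
  rw [← ENNReal.ofReal_natCast T]
  refine ENNReal.ofReal_le_ofReal ((?_ : _ ≤ (logLog n - E) / q).trans (Nat.le_ceil _))
  rw [div_mul_eq_mul_div, one_mul, div_le_div_iff₀ (by positivity) hqpos]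
  nlinarith

/-! ### Arithmetic of `logLogNat` and of the number of destinations. -/

theorem logLogNat_mono : Monotone logLogNat := fun _ _ h => Nat.log_mono_right (Nat.log_mono_right h)

theorem lt_two_pow_two_pow_logLogNat (x : ℕ) : x < 2 ^ 2 ^ (logLogNat x + 1) :=
  (Nat.lt_pow_succ_log_self one_lt_two x).trans_le
    (Nat.pow_le_pow_right two_pos (Nat.lt_pow_succ_log_self one_lt_two _))

theorem logLogNat_two_pow_two_pow (y : ℕ) : logLogNat (2 ^ 2 ^ y) = y := by
  rw [logLogNat, Nat.log_pow one_lt_two, Nat.log_pow one_lt_two]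

/-- The supremum is attained because the fiber is nonempty and bounded. Hence `maxInv logLogNat (y +
1)` occupied points suffice to reach level `y + 1`. -/
theorem logLogNat_maxInv (y : ℕ) : logLogNat (maxInv logLogNat y) = y := by
  have : sSup {x | logLogNat x = y} ∈ {x | logLogNat x = y} := by
    refine Nat.sSup_mem ⟨_, logLogNat_two_pow_two_pow y⟩ ⟨2 ^ 2 ^ (y + 1), ?_⟩
    rintro x rfl
    exact (lt_two_pow_two_pow_logLogNat x).le
  exact this

/-- A choice made at level `y` costs `O(2 ^ y)` bits, so the costs of successive levels grow
geometrically. The constant `20 = 4 + 16` comes from the term `16 * x ^ 4`, with `x < 2 ^ 2 ^ (y +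
2)`. -/
theorem saCount_le (N u : ℕ) :
    saCount logLogNat N u ≤ 2 ^ ((8 * N ^ 3 + 20) * 2 ^ logLogNat u) := by
  set y := logLogNat u with hy
  have hy1 : 1 ≤ 2 ^ y := Nat.one_le_two_pow
  refine max_le ?_ (max_le ?_ ?_)
  · refine Nat.lt_two_pow_self.le.trans (Nat.pow_le_pow_right two_pos ?_)
    exact (Nat.le_add_right _ 20).trans (Nat.le_mul_of_pos_right _ hy1)
  · have h := lt_two_pow_two_pow_logLogNat (maxInv logLogNat (y + 1))
    rw [logLogNat_maxInv] at h
    calc 16 * maxInv logLogNat (y + 1) ^ 4 ≤ 2 ^ 4 * (2 ^ 2 ^ (y + 1 + 1)) ^ 4 :=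
          Nat.mul_le_mul le_rfl (Nat.pow_le_pow_left h.le 4)
      _ = 2 ^ (4 + 16 * 2 ^ y) := by rw [← pow_mul, ← pow_add]; congr 1; ring
      _ ≤ _ := Nat.pow_le_pow_right two_pos (by nlinarith [Nat.zero_le (N ^ 3)])
  · have h := lt_two_pow_two_pow_logLogNat u
    calc u ^ 3 ≤ (2 ^ 2 ^ (y + 1)) ^ 3 := Nat.pow_le_pow_left h.le 3
      _ = 2 ^ (6 * 2 ^ y) := by rw [← pow_mul]; congr 1; ring
      _ ≤ _ := Nat.pow_le_pow_right two_pos (by nlinarith [Nat.zero_le (N ^ 3)])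

theorem zero_mem_localSnapshot (φ : Frame) {C : Config n} {P : Plane} (hP : P ∈ occ C) :
    0 ∈ localSnapshot φ C P := by
  rw [mem_localSnapshot_iff, ← φ.toLocal_self P, φ.toGlobal_toLocal]
  exact hP

theorem card_toFinset_localSnapshot (φ : Frame) (C : Config n) (P : Plane) :
    (localSnapshot φ C P).toFinset.card = (occ C).card := by
  have : (localSnapshot φ C P).toFinset = (occ C).image (φ.toLocal P) := by
    ext X
    rw [Multiset.mem_toFinset, localSnapshot_eq, Multiset.mem_map, Finset.mem_image]
    simp only [mem_occ_iff_mem_map]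
  rw [this, Finset.card_image_of_injective _ (φ.toLocal_injective P)]

/-! ### Analysis of the algorithm: progress and upper bounds. -/

section SA

variable {A : Algorithm} {f : ℕ → ℕ} {N : ℕ}

theorem Algorithm.IsSA.card_destinations (hA : A.IsSA f N) (φ : Frame) {C : Config n}
    {P : Plane} (hP : P ∈ occ C) :
    Multiset.card (A.destinations φ C P) = saCount f N (occ C).card := by
  rw [Scattering.card_destinations, hA.card_dest _ (zero_mem_localSnapshot φ hP),
    ← card_toFinset_localSnapshot φ C P]

theorem Algorithm.IsSA.nodup_destinations (hA : A.IsSA f N) (φ : Frame) {C : Config n}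
    {P : Plane} (hP : P ∈ occ C) : (A.destinations φ C P).Nodup :=
  (hA.nodup _ (zero_mem_localSnapshot φ hP)).map (φ.toGlobal_injective P)

theorem Algorithm.IsSA.mem_voronoiCell (hA : A.IsSA f N) {φ : Frame} {C : Config n}
    {P Q : Plane} (hP : P ∈ occ C) (hQ : Q ∈ A.destinations φ C P) :
    Q ∈ voronoiCell (occ C) P := by
  obtain ⟨X, hX, rfl⟩ := Multiset.mem_map.1 hQ
  intro P' hP' hne
  have h := hA.mem_cell _ (zero_mem_localSnapshot φ hP) X hX (φ.toLocal P P') ?_ ?_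
  · rw [← φ.toLocal_self P, ← φ.toLocal_toGlobal P X, φ.dist_toLocal, φ.dist_toLocal] at h
    exact lt_of_mul_lt_mul_left h φ.scale_pos.le
  · rw [Set.mem_ofPred_eq, mem_localSnapshot_iff, φ.toGlobal_toLocal]
    exact hP'
  · rw [← φ.toLocal_self P]
    exact fun h => hne (φ.toLocal_injective P h)

/-- Robots at distinct locations never meet. -/
theorem Algorithm.IsSA.step_ne (hA : A.IsSA f N) {φ : Plane → Frame} {C D : Config n}
    (hD : D ∈ (A.step φ C).support) {i j : Fin n} (hij : C i ≠ C j) : D i ≠ D j := by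
  intro h
  have hi := hA.mem_voronoiCell (mem_occ.2 ⟨i, rfl⟩) (mem_destinations_of_mem_support_step hD i)
  have hj := hA.mem_voronoiCell (mem_occ.2 ⟨j, rfl⟩) (mem_destinations_of_mem_support_step hD j)
  have h1 := hi (C j) (mem_occ.2 ⟨j, rfl⟩) hij.symm
  have h2 := hj (C i) (mem_occ.2 ⟨i, rfl⟩) hij
  rw [h] at h1
  exact lt_asymm h1 h2

/-- One robot picked at each occupied point: their new locations are distinct by `step_ne`. -/
theorem Algorithm.IsSA.card_occ_le_step (hA : A.IsSA f N) {φ : Plane → Frame} {C D : Config n}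
    (hD : D ∈ (A.step φ C).support) : (occ C).card ≤ (occ D).card := by
  have hex : ∀ P, ∃ Q, P ∈ occ C → ∃ i, C i = P ∧ D i = Q := fun P => by
    by_cases hP : P ∈ occ C
    · obtain ⟨i, hi⟩ := mem_occ.1 hP
      exact ⟨D i, fun _ => ⟨i, hi, rfl⟩⟩
    · exact ⟨0, fun h => absurd h hP⟩
  choose g hg using hex
  refine Finset.card_le_card_of_injOn g (fun P hP => ?_) fun P hP Q hQ hPQ => ?_
  · obtain ⟨i, -, hi⟩ := hg P hP
    exact mem_occ.2 ⟨i, hi⟩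
  · obtain ⟨i, rfl, hi'⟩ := hg P hP
    obtain ⟨j, rfl, hj'⟩ := hg Q hQ
    by_contra hne
    exact hA.step_ne hD hne (by rw [hi', hj', hPQ])

/-- Two coordinates of a uniform tuple coincide with probability at most `1 / k`. -/
theorem card_coincidence_mul_le {ι β : Type*} [Fintype ι] [DecidableEq ι] [DecidableEq β]
    {α : ι → Type*} [∀ i, Fintype (α i)]
    (val : ∀ i, α i → β) {i j : ι} (hinj : Function.Injective (val j)) (hij : i ≠ j) :
    (Finset.univ.filter fun c : ∀ i, α i => val i (c i) = val j (c j)).card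
      * Fintype.card (α j) ≤ Fintype.card (∀ i, α i) := by
  rw [← Finset.card_univ (α := α j), ← Finset.card_product, ← Finset.card_univ]
  -- Resampling coordinate `j` of a coincident tuple loses nothing: the old value is recovered from
  -- coordinate `i`.
  refine Finset.card_le_card_of_injOn (fun p => Function.update p.1 j p.2)
    (fun _ _ => Finset.mem_univ _) ?_
  rintro ⟨c, a⟩ hc ⟨c', a'⟩ hc' h
  have hc1 : val i (c i) = val j (c j) := by simpa using hc
  have hc2 : val i (c' i) = val j (c' j) := by simpa using hc'
  have hoff : ∀ l, l ≠ j → c l = c' l := fun l hl => by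
    simpa [Function.update_of_ne hl] using congrFun h l
  have ha : a = a' := by simpa using congrFun h j
  refine Prod.ext (funext fun l => ?_) ha
  by_cases hl : l = j
  · subst hl
    apply hinj
    change val l (c l) = val l (c' l)
    rw [← hc1, ← hc2, hoff i hij]
  · exact hoff l hl

/-- Union bound over the pairs, each of which meets with probability at most `1 / K`. -/
theorem Algorithm.IsSA.mean_step_meet_le (hA : A.IsSA f N) (φ : Plane → Frame) (C : Config n)
    (Q : Finset (Fin n × Fin n)) (hQ : ∀ p ∈ Q, p.1 ≠ p.2)
    (hcard : 2 * Q.card ≤ saCount f N (occ C).card) :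
    mean (A.step φ C) (fun D => if ∃ p ∈ Q, D p.1 = D p.2 then 1 else 0) ≤ 2⁻¹ := by
  set K := saCount f N (occ C).card with hK
  have := A.nonempty_choices φ C
  set α : Fin n → Type := fun i => (A.destinations (φ (C i)) C (C i)).ToType with hα
  have hval : ∀ i, Function.Injective fun a : α i => a.1 := by
    rintro i ⟨a, s⟩ ⟨b, t⟩ hab
    have hab' : a = b := hab
    subst hab'
    have h1 := Multiset.nodup_iff_count_le_one.1
      (hA.nodup_destinations (φ (C i)) (mem_occ.2 ⟨i, rfl⟩ : C i ∈ occ C)) a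
    have : s = t := Fin.ext (by omega)
    rw [this]
  have hcardα : ∀ i, Fintype.card (α i) = K := fun i => by
    rw [Multiset.card_coe, hA.card_destinations _ (mem_occ.2 ⟨i, rfl⟩)]
  set bad := Finset.univ.filter fun c : ∀ i, α i => ∃ p ∈ Q, (c p.1).1 = (c p.2).1 with hbad
  have hbadle : bad.card * K ≤ Q.card * Fintype.card (∀ i, α i) := by
    have hsub : bad ⊆ Q.biUnion fun p =>
        Finset.univ.filter fun c : ∀ i, α i => (c p.1).1 = (c p.2).1 := by
      intro c hc
      obtain ⟨p, hp, h⟩ := (Finset.mem_filter.1 hc).2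
      exact Finset.mem_biUnion.2 ⟨p, hp, Finset.mem_filter.2 ⟨Finset.mem_univ _, h⟩⟩
    calc bad.card * K ≤ (∑ p ∈ Q,
          (Finset.univ.filter fun c : ∀ i, α i => (c p.1).1 = (c p.2).1).card) * K :=
          Nat.mul_le_mul_right _ ((Finset.card_le_card hsub).trans Finset.card_biUnion_le)
      _ = ∑ p ∈ Q,
          (Finset.univ.filter fun c : ∀ i, α i => (c p.1).1 = (c p.2).1).card * K :=
          Finset.sum_mul _ _ _
      _ ≤ ∑ _p ∈ Q, Fintype.card (∀ i, α i) := by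
          refine Finset.sum_le_sum fun p hp => ?_
          rw [← hcardα p.2]
          exact card_coincidence_mul_le (fun i (a : α i) => a.1) (hval p.2) (hQ p hp)
      _ = _ := by rw [Finset.sum_const, smul_eq_mul]
  have hbad2 : 2 * bad.card ≤ Fintype.card (∀ i, α i) := by
    rcases Nat.eq_zero_or_pos K with h0 | hpos
    · have : Q = ∅ := Finset.card_eq_zero.1 (by omega)
      simp [hbad, this]
    · refine Nat.le_of_mul_le_mul_right (c := K) ?_ hpos
      nlinarith
  have hmean : mean (A.step φ C) (fun D => if ∃ p ∈ Q, D p.1 = D p.2 then 1 else 0)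
      = bad.card / Fintype.card (∀ i, α i) := by
    rw [Algorithm.step, mean_map, ← mean_uniform_indicator bad]
    refine congrArg _ (funext fun c => ?_)
    simp [hbad]
  rw [hmean]
  refine ENNReal.div_le_of_le_mul ?_
  have : (2 : ℝ≥0∞) * bad.card ≤ Fintype.card (∀ i, α i) := by exact_mod_cast hbad2
  calc (bad.card : ℝ≥0∞) = 2⁻¹ * (2 * bad.card) := by
        rw [← mul_assoc, ENNReal.inv_mul_cancel (by norm_num) (by norm_num), one_mul]
    _ ≤ _ := by gcongr

/-- The progress measure of the algorithm. -/
def level (C : Config n) : ℕ := logLogNat (occ C).card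

/-- There are few pairs of robots whose separation scatters the robots or raises the level. Either
all groups are small compared with the number of destinations, and all pairs of robots that share
a location are few; or some group is so large that the separation of a part of it suffices. This
birthday argument needs no property of the constant `N`. -/
theorem exists_pairs_forcing_progress (hA : A.IsSA logLogNat N) (φ : Plane → Frame)
    (C : Config n) (hC : ¬ Scattered C) :
    ∃ Q : Finset (Fin n × Fin n), (∀ p ∈ Q, p.1 ≠ p.2) ∧
      2 * Q.card ≤ saCount logLogNat N (occ C).card ∧
      ∀ D ∈ (A.step φ C).support, (∀ p ∈ Q, D p.1 ≠ D p.2) →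
        Scattered D ∨ level C + 1 ≤ level D := by
  set u := (occ C).card with hu
  set x := maxInv logLogNat (logLogNat u + 1) with hx
  set K := saCount logLogNat N u with hK
  have hKx : 16 * x ^ 4 ≤ K := (le_max_left _ _).trans (le_max_right _ _)
  have hKu : u ^ 3 ≤ K := (le_max_right _ _).trans (le_max_right _ _)
  by_cases hlarge : ∃ P, K < 8 * multiplicity C P ^ 3
  · obtain ⟨P, hP⟩ := hlarge
    set m := multiplicity C P with hm
    -- `16 * x ^ 4 ≤ K < 8 * m ^ 3` leaves room for `x` robots inside the group. Separating just
    -- these occupies `x` points, which is the next level.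
    have hxm : x ≤ m := by
      by_contra hlt
      have h1 : m ^ 3 ≤ x ^ 3 := Nat.pow_le_pow_left (by omega) 3
      have h2 : x ^ 3 ≤ x ^ 4 := Nat.pow_le_pow_right (by omega) (by omega)
      omega
    obtain ⟨R, hR, hRx⟩ := Finset.exists_subset_card_eq hxm
    refine ⟨R.offDiag, fun p hp => (Finset.mem_offDiag.1 hp).2.2, ?_, fun D hD hsep => Or.inr ?_⟩
    · rw [Finset.offDiag_card, hRx]
      have : x * x ≤ x ^ 4 := by
        rw [← pow_two]
        rcases Nat.eq_zero_or_pos x with h | h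
        · simp [h]
        · exact Nat.pow_le_pow_right h (by norm_num)
      omega
    · have hinj : Set.InjOn D R := fun i hi j hj hij => by
        by_contra hne
        exact hsep (i, j) (Finset.mem_offDiag.2 ⟨hi, hj, hne⟩) hij
      have h1 : x ≤ (occ D).card := by
        rw [← hRx, ← Finset.card_image_of_injOn hinj]
        exact Finset.card_le_card (Finset.image_subset_image (Finset.subset_univ _))
      have h2 := logLogNat_mono h1
      rw [hx, logLogNat_maxInv] at h2
      exact h2
  · push Not at hlarge
    refine ⟨Finset.univ.filter fun p => p.1 ≠ p.2 ∧ C p.1 = C p.2,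
      fun p hp => (Finset.mem_filter.1 hp).2.1, ?_, fun D hD hsep => Or.inl ?_⟩
    · have hn : 0 < n := by
        rcases Nat.eq_zero_or_pos n with rfl | h
        · exact absurd (Function.injective_of_subsingleton C) hC
        · exact h
      have hu0 : 0 < u := occ_card_pos hn C
      have hcard : (Finset.univ.filter fun p : Fin n × Fin n => p.1 ≠ p.2 ∧ C p.1 = C p.2).card
          ≤ ∑ P ∈ occ C, multiplicity C P ^ 2 := by
        have hsub : (Finset.univ.filter fun p : Fin n × Fin n => p.1 ≠ p.2 ∧ C p.1 = C p.2) ⊆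
            (occ C).biUnion fun P => (Finset.univ.filter fun i => C i = P) ×ˢ
              (Finset.univ.filter fun i => C i = P) := by
          rintro ⟨i, j⟩ hp
          have hij := (Finset.mem_filter.1 hp).2.2
          refine Finset.mem_biUnion.2 ⟨C i, mem_occ.2 ⟨i, rfl⟩, ?_⟩
          simpa using hij.symm
        refine (Finset.card_le_card hsub).trans (Finset.card_biUnion_le.trans (le_of_eq ?_))
        refine Finset.sum_congr rfl fun P _ => ?_
        rw [Finset.card_product, pow_two]
        rfl
      -- Compare cubes: `(2 u m²)³ = u³ * 8 m³ * m³ ≤ K³`. Summing over the `u` occupied points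
      -- bounds the number of pairs.
      have hP : ∀ P ∈ occ C, u * (2 * multiplicity C P ^ 2) ≤ K := by
        intro P _
        set m := multiplicity C P
        have hm : 8 * m ^ 3 ≤ K := hlarge P
        by_contra hlt
        push Not at hlt
        have h1 : K ^ 3 < (u * (2 * m ^ 2)) ^ 3 := Nat.pow_lt_pow_left hlt (by norm_num)
        have h2 : (u * (2 * m ^ 2)) ^ 3 ≤ K ^ 3 := by
          calc (u * (2 * m ^ 2)) ^ 3 = u ^ 3 * (8 * m ^ 3) * (m ^ 3) := by ring
            _ ≤ K * K * K := Nat.mul_le_mul (Nat.mul_le_mul hKu hm) (by omega)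
            _ = K ^ 3 := by ring
        omega
      refine le_of_mul_le_mul_left ?_ hu0
      calc u * (2 * (Finset.univ.filter fun p : Fin n × Fin n => p.1 ≠ p.2 ∧ C p.1 = C p.2).card)
          ≤ u * (2 * ∑ P ∈ occ C, multiplicity C P ^ 2) := by gcongr
        _ = ∑ P ∈ occ C, u * (2 * multiplicity C P ^ 2) := by rw [Finset.mul_sum, Finset.mul_sum]
        _ ≤ ∑ _P ∈ occ C, K := Finset.sum_le_sum hP
        _ = u * K := by rw [Finset.sum_const, smul_eq_mul]
    · intro i j hij
      by_contra hne
      by_cases hCij : C i = C j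
      · exact hsep (i, j) (Finset.mem_filter.2 ⟨Finset.mem_univ _, hne, hCij⟩) hij
      · exact hA.step_ne hD hCij hij

theorem level_le (C : Config n) : level C ≤ logLogNat n := logLogNat_mono (occ_card_le C)

/-- At every level, the algorithm spends two rounds in expectation. -/
theorem Algorithm.IsSA.expectedTotal_le (hA : A.IsSA logLogNat N) (adv : Adversary n)
    (C₀ : Config n) (w : History n → ℝ≥0∞) (g : ℕ → ℝ≥0∞) (hw : ∀ h, w h ≤ g (level h.1)) :
    A.expectedTotal adv C₀ w ≤ 2 * ∑ y ∈ Finset.range (logLogNat n + 1), g y := by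
  set F := logLogNat n with hF
  refine (Scattering.expectedTotal_le A adv C₀ w
    (fun C => 2 * ∑ y ∈ Finset.Icc (level C) F, g y) fun h hs => ?_).trans ?_
  · obtain ⟨Q, hQne, hQcard, hQ⟩ := exists_pairs_forcing_progress hA (adv h) h.1 hs
    set l := level h.1 with hl
    set b := 2 * ∑ y ∈ Finset.Ioc l F, g y with hb
    have hV : 2 * ∑ y ∈ Finset.Icc l F, g y = b + 2 * g l := by
      rw [← Finset.sum_Ioc_add_eq_sum_Icc (level_le h.1), mul_add]
    -- The potential charges `2 * g y` for each level still to be visited. Progress leaves at most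
    -- `b`, failure at most `b + 2 * g l`; failure has probability at most one half, so the expected
    -- drop pays `g l`.
    have hbound : ∀ D ∈ (A.step (adv h) h.1).support,
        (if Scattered D then 0 else 2 * ∑ y ∈ Finset.Icc (level D) F, g y) ≤
          b + 2 * g l * if ∃ p ∈ Q, D p.1 = D p.2 then 1 else 0 := by
      intro D hD
      split_ifs with h1 h2 h2
      · exact zero_le
      · exact zero_le
      · rw [mul_one, ← hV]
        gcongr
        exact logLogNat_mono (hA.card_occ_le_step hD)
      · push Not at h2
        have hlev : l + 1 ≤ level D := (hQ D hD h2).resolve_left h1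
        rw [mul_zero, add_zero, hb]
        gcongr
        intro y hy
        rw [Finset.mem_Icc] at hy
        exact Finset.mem_Ioc.2 ⟨by omega, hy.2⟩
    change w h + _ ≤ 2 * ∑ y ∈ Finset.Icc l F, g y
    rw [hV]
    calc w h + mean (A.step (adv h) h.1)
          (fun D => if Scattered D then 0 else 2 * ∑ y ∈ Finset.Icc (level D) F, g y)
        ≤ g l + (b + 2 * g l * 2⁻¹) := by
          refine add_le_add (hw h) ((mean_mono hbound).trans ?_)
          rw [mean_add, mean_const, mean_const_mul]
          gcongr
          exact hA.mean_step_meet_le (adv h) h.1 Q hQne hQcard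
      _ = b + 2 * g l := by
          rw [mul_right_comm, ENNReal.mul_inv_cancel (by norm_num) (by norm_num), one_mul, two_mul,
            add_left_comm]
  · gcongr
    intro y hy
    rw [Finset.mem_Icc] at hy
    exact Finset.mem_range.2 (by omega)

theorem Algorithm.IsSA.rounds_le (hA : A.IsSA logLogNat N) (n : ℕ) :
    A.rounds n ≤ (2 * (logLogNat n + 1) : ℕ) := by
  refine iSup₂_le fun adv C₀ => (hA.expectedTotal_le adv C₀ _ (fun _ => 1) fun _ => le_rfl).trans ?_
  simp

theorem Algorithm.IsSA.isScattering (hA : A.IsSA logLogNat N) : A.IsScattering :=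
  isScattering_of_rounds_ne_top A fun n =>
    ne_top_of_le_ne_top (ENNReal.natCast_ne_top _) (hA.rounds_le n)

theorem Algorithm.IsSA.roundBits_le (hA : A.IsSA logLogNat N) (φ : Plane → Frame) (C : Config n) :
    A.roundBits φ C ≤ (n * ((8 * N ^ 3 + 20) * 2 ^ level C) : ℕ) := by
  have hi : ∀ i ∈ (Finset.univ : Finset (Fin n)), (if 2 ≤ multiplicity C (C i) then
      ENNReal.ofReal (Real.logb 2 (Multiset.card (A.destinations (φ (C i)) C (C i)))) else 0)
      ≤ ((8 * N ^ 3 + 20) * 2 ^ level C : ℕ) := by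
    intro i _
    split_ifs
    · have h1 := saCount_le N (occ C).card
      rw [← hA.card_destinations (φ (C i)) (mem_occ.2 ⟨i, rfl⟩)] at h1
      rw [← ENNReal.ofReal_natCast]
      refine ENNReal.ofReal_le_ofReal ?_
      rw [Real.logb_le_iff_le_rpow (by norm_num)
        (by exact_mod_cast one_le_card_destinations A (φ (C i)) C (C i)), Real.rpow_natCast]
      exact_mod_cast h1
    · exact zero_le
  refine (Finset.sum_le_sum hi).trans (le_of_eq ?_)
  rw [Finset.sum_const, Finset.card_univ, Fintype.card_fin, nsmul_eq_mul, Nat.cast_mul n]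

/-- The top level dominates the geometric sum, so the number of levels does not appear as a factor.
-/
theorem Algorithm.IsSA.bits_le (hA : A.IsSA logLogNat N) (n : ℕ) :
    A.bits n ≤ (4 * (8 * N ^ 3 + 20) * (n * 2 ^ logLogNat n) : ℕ) := by
  refine iSup₂_le fun adv C₀ => (hA.expectedTotal_le adv C₀ _
    (fun y => (n * ((8 * N ^ 3 + 20) * 2 ^ y) : ℕ)) fun h => hA.roundBits_le (adv h) h.1).trans ?_
  rw [← Nat.cast_sum, ← Nat.cast_ofNat, ← Nat.cast_mul, Nat.cast_le, ← Finset.mul_sum,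
    ← Finset.mul_sum]
  have h := Nat.geomSum_lt (m := 2) (n := logLogNat n + 1) (s := Finset.range (logLogNat n + 1))
    le_rfl (by simp)
  rw [pow_succ] at h
  calc 2 * (n * ((8 * N ^ 3 + 20) * ∑ y ∈ Finset.range (logLogNat n + 1), 2 ^ y))
      ≤ 2 * (n * ((8 * N ^ 3 + 20) * (2 ^ logLogNat n * 2))) := by gcongr
    _ = _ := by ring

theorem two_pow_logLogNat_le (hn : 4 ≤ n) : (2 : ℝ) ^ logLogNat n ≤ Real.logb 2 n := by
  have h1 : 2 ≤ Nat.log 2 n := by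
    rw [Nat.le_log_iff_pow_le one_lt_two (by omega)]
    omega
  have h2 : 2 ^ logLogNat n ≤ Nat.log 2 n := Nat.pow_log_le_self 2 (by omega)
  have h3 : ((2 ^ logLogNat n : ℕ) : ℝ) ≤ Nat.log 2 n := by exact_mod_cast h2
  push_cast at h3
  exact h3.trans (Real.natLog_le_logb n 2)

theorem Algorithm.IsSA.bits_isBigO (hA : A.IsSA logLogNat N) : IsBigO A.bits nLog := by
  refine ⟨4 * (8 * N ^ 3 + 20), by positivity, ?_⟩
  filter_upwards [eventually_ge_atTop 4] with n hn
  refine (hA.bits_le n).trans ?_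
  rw [← ENNReal.ofReal_natCast]
  refine ENNReal.ofReal_le_ofReal ?_
  have := two_pow_logLogNat_le hn
  rw [nLog]
  push_cast
  gcongr

theorem Algorithm.IsSA.rounds_isBigO (hA : A.IsSA logLogNat N) : IsBigO A.rounds logLog := by
  refine ⟨4, by norm_num, ?_⟩
  filter_upwards [eventually_ge_atTop 4, tendsto_logLog.eventually_ge_atTop 1] with n hn h1
  refine (hA.rounds_le n).trans ?_
  rw [← ENNReal.ofReal_natCast]
  refine ENNReal.ofReal_le_ofReal ?_
  have h2 := two_pow_logLogNat_le hn
  have h3 : (logLogNat n : ℝ) ≤ logLog n := by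
    rw [logLog, Real.le_logb_iff_rpow_le (by norm_num) (lt_of_lt_of_le (by positivity) h2),
      Real.rpow_natCast]
    exact h2
  push_cast
  linarith

theorem Algorithm.NoDetection.globalWeakDetection (h : A.NoDetection) : A.GlobalWeakDetection :=
  fun S S' hS _ => h S S' hS

end SA

/-! ### Existence of an implementation, and the conclusion. -/

/-- Finitely many strict inequalities that hold at `0` hold in a neighborhood of `0`, which is
infinite. -/
theorem exists_finset_subset_voronoiCell (U : Finset Plane) (k : ℕ) :
    ∃ t : Finset Plane, (t : Set Plane) ⊆ voronoiCell U 0 ∧ t.card = k := by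
  have hmem : voronoiCell (U : Set Plane) 0 ∈ 𝓝 (0 : Plane) := by
    have : ∀ P ∈ U, ∀ᶠ Q in 𝓝 (0 : Plane), P ≠ 0 → dist Q 0 < dist Q P := by
      intro P _
      by_cases hP : P = 0
      · simp [hP]
      · have hlt : dist (0 : Plane) 0 < dist (0 : Plane) P := by
          rw [dist_self]
          exact dist_pos.2 (Ne.symm hP)
        have h1 : ContinuousAt (fun Q : Plane => dist Q 0) 0 := by fun_prop
        have h2 : ContinuousAt (fun Q : Plane => dist Q P) 0 := by fun_prop
        exact (h1.eventually_lt h2 hlt).mono fun Q hQ _ => hQ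
    exact (Filter.eventually_all_finset U).2 this
  have : NeBot (𝓝[≠] (0 : Plane)) := Module.punctured_nhds_neBot ℝ Plane 0
  exact (infinite_of_mem_nhds (0 : Plane) hmem).exists_subset_card_eq k

theorem exists_isSA (f : ℕ → ℕ) (N : ℕ) : ∃ A : Algorithm, A.IsSA f N := by
  choose t ht hcard using exists_finset_subset_voronoiCell
  -- The choice depends on `S.toFinset` only, hence on no multiplicity. The value `{0}` is a dummy
  -- for snapshots that do not contain the observer.
  refine ⟨⟨fun S => if 0 ∈ S then (t S.toFinset (saCount f N S.toFinset.card)).val else {0}, ?_⟩,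
    ?_, ?_, ?_, ?_⟩
  · intro S
    split_ifs with h
    · rw [Ne, Finset.val_eq_zero, ← Finset.card_eq_zero, hcard]
      have hpos : 0 < S.toFinset.card := Finset.card_pos.2 ⟨0, Multiset.mem_toFinset.2 h⟩
      have : S.toFinset.card ^ 3 ≤ saCount f N S.toFinset.card :=
        (le_max_right _ _).trans (le_max_right _ _)
      have := Nat.pow_pos (n := 3) hpos
      omega
    · exact Multiset.singleton_ne_zero 0
  · intro S S' h
    have : S.toFinset = S'.toFinset := by
      ext Q
      simpa using h Q
    simp only [h 0, this]
  · intro S hS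
    simp only [if_pos hS]
    exact Finset.nodup _
  · intro S hS
    simp only [if_pos hS, Finset.card_val, hcard]
  · intro S hS Q hQ
    simp only [if_pos hS] at hQ
    have := ht S.toFinset (saCount f N S.toFinset.card) hQ
    simpa [voronoiCell] using this

end

end Scattering

theorem mainTheorem9 :
    -- the constant used by the algorithm exists
    (∃ N : ℕ, Scattering.IsThreshold N) ∧
    ∀ N : ℕ, Scattering.IsThreshold N →
      -- the algorithm can be implemented
      (∃ A : Scattering.Algorithm, A.IsSA Scattering.logLogNat N) ∧
      -- every implementation scatters, in `Θ(log log n)` rounds and with `Θ(n log n)` bits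
      (∀ A : Scattering.Algorithm, A.IsSA Scattering.logLogNat N →
        A.IsScattering ∧
        Scattering.IsBigTheta A.rounds Scattering.logLog ∧
        Scattering.IsBigTheta A.bits Scattering.nLog) ∧
      -- every scattering algorithm, with any multiplicity detection, uses `n log n` bits
      (∀ B : Scattering.Algorithm, B.IsScattering →
        ∀ n : ℕ, ENNReal.ofReal (Scattering.nLog n) ≤ B.bits n) ∧
      -- random bit optimal algorithms without strong detection need `Ω(log log n)` rounds
      (∀ B : Scattering.Algorithm, B.IsScattering → B.GlobalWeakDetection →
        Scattering.IsBigO B.bits Scattering.nLog →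
        Scattering.IsBigOmega B.rounds Scattering.logLog) := by
  refine ⟨⟨_, Scattering.isThreshold_of_large⟩, fun N _ => ⟨Scattering.exists_isSA _ N, ?_,
    Scattering.nLog_le_bits, fun B _ hB hbits => Scattering.rounds_isBigOmega hB hbits⟩⟩
  intro A hA
  -- The lower halves of both `Θ` bounds are the general lower bounds, applied to `A` itself.
  refine ⟨hA.isScattering, ⟨hA.rounds_isBigO, Scattering.rounds_isBigOmega
    hA.noDetection.globalWeakDetection hA.bits_isBigO⟩, hA.bits_isBigO, 1, one_pos, ?_⟩
  refine Filter.Eventually.of_forall fun n => ?_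
  rw [one_mul]
  exact Scattering.nLog_le_bits A hA.isScattering n
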